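/- Let $p$ be a prime number, let $F$ and $E$ be finite extensions of $\mathbb{Q}_p$, let $S=\mathrm{Hom}_{\mathbb{Q}_p\text{-alg}}(F,E)$ and suppose $|S|=[F:\mathbb{Q}_p]$. Let $\mathrm{val}_{\mathbb{Q}_p}$ be the $p$-adic valuation on $E$ with $\mathrm{val}_{\mathbb{Q}_p}(p)=1$. Put $G=\mathrm{GL}_2(F)$ and let $P\subset G$ be the subgroup of upper triangular matrices. Let $J\subseteq S$, let $\underline{d}=(d_\sigma)_{\sigma\in S\setminus J}$ be a family of integers $d_\sigma\ge 0$, put $|\underline{d}|=\sum_{\sigma\in S\setminus J}d_\sigma$, and let $\chi_1,\chi_2\colon F^\times\to E^\times$ be two locally $J$-analytic characters (that is, near each $a\in F^\times$ they are given by a convergent power series in the $\sigma(z-a)$, $\sigma\in J$). Consider the locally convex representation of $G$ $$I(\chi,J,\underline{d})=\Big(\bigotimes_{\sigma\in S\setminus J}(\mathrm{Sym}^{d_\sigma}E^2)^{\sigma}\Big)\otimes_E\big(\mathrm{Ind}_P^G\,\chi_1\otimes\chi_2\big)^{J\text{-an}},$$ where $G$ acts on $(\mathrm{Sym}^{d_\sigma}E^2)^\sigma$,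 the $d_\sigma$-th symmetric power of the standard representation, through $\sigma\colon G\to \mathrm{GL}_2(E)$, and where $(\mathrm{Ind}_P^G\chi_1\otimes\chi_2)^{J\text{-an}}$ is the space of locally $J$-analytic functions $f\colon G\to E$ such that $f(bg)=\chi_1(b_{11})\chi_2(b_{22})f(g)$ for all $b=\begin{pmatrix} b_{11}&b_{12}\\0&b_{22}\end{pmatrix}\in P$ and $g\in G$, with its usual locally convex topology and with $G$ acting by right translation. A unitary $G$-Banach space is a (non-archimedean) Banach space over $E$ with a continuous action $G\times B\to B$ for which some norm defining the topology of $B$ is $G$-invariant. A universal unitary completion of $I(\chi,J,\underline{d})$ is a unitary $G$-Banach space $I(\chi,J,\underline{d})^{\wedge}$ together with a continuous $E$-linear $G$-equivariant map $\iota\colon I(\chi,J,\underline{d})\to I(\chi,J,\underline{d})^{\wedge}$ through which every continuous $E$-linear $G$-equivariant map from $I(\chi,J,\underline{d})$ to a unitary $G$-Banach space factors uniquely. If the universal unitary completion $I(\chi,J,\underline{d})^{\wedge}$ is nonzero, then: (i) the central character of $I(\chi,J,\underline{d})$ is integral, that is, the centre $F^\times$ of $G$ acts on $I(\chi,J,\underline{d})$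 through a character with values in $\mathcal{O}_E^\times$; in particular $\mathrm{val}_{\mathbb{Q}_p}(\chi_1(p))+\mathrm{val}_{\mathbb{Q}_p}(\chi_2(p))+|\underline{d}|=0$; (ii) $\mathrm{val}_{\mathbb{Q}_p}(\chi_2(p))+|\underline{d}|\ge 0$. -/

import Mathlib

open scoped TensorProduct

noncomputable section

namespace PadicGL2

/-! Throughout, `F` and `E` are finite extensions of `ℚ_[p]`, each with the (unique) absolute value
that extends the one of `ℚ_[p]`, so `‖p‖ = 1/p`; `S = (F →ₐ[ℚ_[p]] E)` is the set of embeddings,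
`J ⊆ S`, and `G = GL (Fin 2) F`. -/

/-- The radius `p⁻ʰ = ‖pʰ‖` of the disc `a + pʰ 𝒪_F`. -/
def radius (p h : ℕ) : ℝ := ((p : ℝ)⁻¹) ^ h

theorem radius_nonneg (p h : ℕ) : 0 ≤ radius p h := by
  unfold radius; positivity

section Analytic

variable {p : ℕ} [Fact p.Prime]
variable {F : Type*} [NontriviallyNormedField F] [NormedAlgebra ℚ_[p] F]
variable {E : Type*} [NontriviallyNormedField E] [NormedAlgebra ℚ_[p] E]

/-- The family `c` of coefficients is an expansion of `f : X → E` (with `X ⊆ F`) as a convergent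
power series on `X ∩ (a + pʰ 𝒪_F)` in the "variables" `σ(z - a)`, `σ ∈ J`:
`f z = ∑ₘ cₘ ∏_{σ ∈ J} σ(z - a) ^ m_σ`, with `‖cₘ‖ ‖pʰ‖ ^ |m| → 0`. -/
def IsDiscExpansion (J : Finset (F →ₐ[ℚ_[p]] E)) (X : Set F) (f : X → E) (a : F) (h : ℕ)
    (c : (J → ℕ) → E) : Prop :=
  Filter.Tendsto (fun m : J → ℕ => ‖c m‖ * radius p h ^ (∑ σ, m σ)) Filter.cofinite (nhds 0) ∧
  ∀ z : X, ‖(z : F) - a‖ ≤ radius p h →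
    HasSum (fun m : J → ℕ => c m * ∏ σ : J, σ.1 ((z : F) - a) ^ m σ) (f z)

/-- A character `χ : Fˣ → Eˣ` (extended by `χ 0 = 0`) is locally `J`-analytic: near every point of
`Fˣ` it is given by a convergent power series in the `σ(z - a)`, `σ ∈ J`. -/
def IsLocallyAnalyticChar (J : Finset (F →ₐ[ℚ_[p]] E)) (χ : F →*₀ E) : Prop :=
  ∀ a : F, a ≠ 0 → ∃ h : ℕ, ∃ c : (J → ℕ) → E,
    IsDiscExpansion J {x : F | x ≠ 0} (fun x => χ x) a h c

/-- The ring of integers `𝒪_F`, as a set. -/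
def intSet (F : Type*) [NontriviallyNormedField F] : Set F := {z | ‖z‖ ≤ 1}

theorem radius_anti {h k : ℕ} (hk : h ≤ k) : radius p k ≤ radius p h := by
  unfold radius
  have hp : (1 : ℝ) ≤ p := by exact_mod_cast (Fact.out : p.Prime).one_lt.le
  exact pow_le_pow_of_le_one (by positivity) (inv_le_one_of_one_le₀ hp) hk

theorem IsDiscExpansion.mono {J : Finset (F →ₐ[ℚ_[p]] E)} {X : Set F} {f : X → E} {a : F}
    {h k : ℕ} (hk : h ≤ k) {c : (J → ℕ) → E} (H : IsDiscExpansion J X f a h c) :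
    IsDiscExpansion J X f a k c := by
  refine ⟨squeeze_zero (fun m => ?_) (fun m => ?_) H.1,
    fun z hz => H.2 z (hz.trans (radius_anti hk))⟩
  · exact mul_nonneg (norm_nonneg _) (pow_nonneg (radius_nonneg p k) _)
  · exact mul_le_mul_of_nonneg_left
      (pow_le_pow_left₀ (radius_nonneg p k) (radius_anti hk) _) (norm_nonneg _)

theorem IsDiscExpansion.add {J : Finset (F →ₐ[ℚ_[p]] E)} {X : Set F} {f g : X → E} {a : F}
    {h : ℕ} {c e : (J → ℕ) → E} (H : IsDiscExpansion J X f a h c)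
    (K : IsDiscExpansion J X g a h e) : IsDiscExpansion J X (f + g) a h (c + e) := by
  refine ⟨squeeze_zero (fun m => ?_) (fun m => ?_) (by simpa using H.1.add K.1),
    fun z hz => ?_⟩
  · exact mul_nonneg (norm_nonneg _) (pow_nonneg (radius_nonneg p h) _)
  · rw [← add_mul]
    exact mul_le_mul_of_nonneg_right (norm_add_le _ _) (pow_nonneg (radius_nonneg p h) _)
  · simpa [add_mul] using (H.2 z hz).add (K.2 z hz)

theorem IsDiscExpansion.smul {J : Finset (F →ₐ[ℚ_[p]] E)} {X : Set F} {f : X → E} {a : F}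
    {h : ℕ} {c : (J → ℕ) → E} (t : E) (H : IsDiscExpansion J X f a h c) :
    IsDiscExpansion J X (t • f) a h (t • c) := by
  refine ⟨?_, fun z hz => ?_⟩
  · simpa [norm_mul, mul_assoc] using H.1.const_mul ‖t‖
  · simpa [mul_assoc] using (H.2 z hz).mul_left t

theorem IsDiscExpansion.zero (J : Finset (F →ₐ[ℚ_[p]] E)) (X : Set F) (a : F) (h : ℕ) :
    IsDiscExpansion J X (0 : X → E) a h 0 := by
  refine ⟨by simpa using tendsto_const_nhds, fun z _ => by simp⟩

/-- The space `𝓕(𝒪_F, J)` of locally `J`-analytic functions on `𝒪_F`: the union over `h` of the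
Banach spaces `𝓕_h` of functions that have a convergent expansion on every disc of radius `‖pʰ‖`
in `𝒪_F`. (The discs `a + pʰ 𝒪_F` are cofinal among all the discs `a + ϖⁿ 𝒪_F`.) -/
def locAn (J : Finset (F →ₐ[ℚ_[p]] E)) : Submodule E (intSet F → E) where
  carrier := {f | ∃ h : ℕ, ∀ a : intSet F, ∃ c, IsDiscExpansion J (intSet F) f a h c}
  zero_mem' := ⟨0, fun a => ⟨0, IsDiscExpansion.zero J _ _ _⟩⟩
  add_mem' := by
    rintro f g ⟨h, hf⟩ ⟨k, hg⟩
    refine ⟨max h k, fun a => ?_⟩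
    obtain ⟨c, hc⟩ := hf a
    obtain ⟨e, he⟩ := hg a
    exact ⟨c + e, (hc.mono (le_max_left h k)).add (he.mono (le_max_right h k))⟩
  smul_mem' := by
    rintro t f ⟨h, hf⟩
    refine ⟨h, fun a => ?_⟩
    obtain ⟨c, hc⟩ := hf a
    exact ⟨t • c, hc.smul t⟩

/-- `f` belongs to the Banach space `𝓕_h` and its norm there, the supremum over the discs of radius
`‖pʰ‖` and over `m` of `‖cₘ‖ ‖pʰ‖ ^ |m|`, is at most `B`. -/
def NormLE (J : Finset (F →ₐ[ℚ_[p]] E)) (h : ℕ) (f : intSet F → E) (B : ℝ) : Prop :=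
  ∀ a : intSet F, ∃ c, IsDiscExpansion J (intSet F) f a h c ∧
    ∀ m, ‖c m‖ * radius p h ^ (∑ σ, m σ) ≤ B

/-- A non-archimedean seminorm on `𝓕(𝒪_F, J)` whose restriction to each of the Banach spaces `𝓕_h`
is continuous (that is, bounded). -/
def IsAdmissibleSeminorm (J : Finset (F →ₐ[ℚ_[p]] E)) (q : Seminorm E (locAn J)) : Prop :=
  (∀ x y, q (x + y) ≤ max (q x) (q y)) ∧
  ∀ h : ℕ, ∃ C : ℝ, ∀ (f : locAn J) (B : ℝ), NormLE J h f.1 B → q f ≤ C * B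

instance (J : Finset (F →ₐ[ℚ_[p]] E)) :
    Nonempty {q : Seminorm E (locAn J) // IsAdmissibleSeminorm J q} :=
  ⟨⟨0, by simp, fun _ => ⟨0, by simp⟩⟩⟩

/-- The locally convex inductive limit topology on `𝓕(𝒪_F, J) = ⋃ₕ 𝓕_h`: the one defined by all
the non-archimedean seminorms that are continuous on every `𝓕_h`. -/
@[reducible] def locAnTopology (J : Finset (F →ₐ[ℚ_[p]] E)) : TopologicalSpace (locAn J) :=
  (SeminormFamily.moduleFilterBasis
    (fun q : {q : Seminorm E (locAn J) // IsAdmissibleSeminorm J q} => q.1)).topology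

end Analytic

section Induced

variable {p : ℕ} [Fact p.Prime]
variable {F : Type*} [NontriviallyNormedField F] [NormedAlgebra ℚ_[p] F]
variable {E : Type*} [NontriviallyNormedField E] [NormedAlgebra ℚ_[p] E]

/-- The matrix `[0, 1; -1, z]`. The maps `(b, z) ↦ b * chart₀ z * g` from `P × 𝒪_F` to `G`, for
`g ∈ G`, are `F`-analytic isomorphisms onto open subsets of `G`, and these subsets cover `G`. -/
def chart₀ (z : F) : GL (Fin 2) F :=
  Matrix.GeneralLinearGroup.mkOfDetNeZero !![0, 1; -1, z] (by simp [Matrix.det_fin_two])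

/-- The matrix `[1, 0; z, -1]`. -/
def chart₁ (z : F) : GL (Fin 2) F :=
  Matrix.GeneralLinearGroup.mkOfDetNeZero !![1, 0; z, -1] (by simp [Matrix.det_fin_two])

theorem chart₁_eq (z : F) : chart₁ z = chart₀ z *
    Matrix.GeneralLinearGroup.mkOfDetNeZero !![0, 1; 1, 0] (by simp [Matrix.det_fin_two]) := by
  ext i j
  fin_cases i <;> fin_cases j <;>
    simp [chart₀, chart₁, Matrix.GeneralLinearGroup.mkOfDetNeZero]

/-- The locally `J`-analytic parabolic induction `(Ind_P^G χ₁ ⊗ χ₂)^{J-an}`: the functions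
`φ : G → E` with `φ(bg) = χ₁(b₀₀) χ₂(b₁₁) φ(g)` for all upper triangular `b`, that are locally
`J`-analytic. Since `b ↦ χ₁(b₀₀) χ₂(b₁₁)` is locally `J`-analytic, the latter means that in each of
the charts `(b, z) ↦ b * chart₀ z * g` of `G` the function is locally `J`-analytic in `z ∈ 𝒪_F`. -/
def ind (χ₁ χ₂ : F →*₀ E) (J : Finset (F →ₐ[ℚ_[p]] E)) : Submodule E (GL (Fin 2) F → E) where
  carrier := {φ | (∀ b g : GL (Fin 2) F, b 1 0 = 0 → φ (b * g) = χ₁ (b 0 0) * χ₂ (b 1 1) * φ g) ∧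
    ∀ g : GL (Fin 2) F, (fun z : intSet F => φ (chart₀ (z : F) * g)) ∈ locAn J}
  zero_mem' := ⟨by simp, fun _ => (locAn J).zero_mem⟩
  add_mem' := fun {φ ψ} hφ hψ =>
    ⟨fun b g hb => by simp [hφ.1 b g hb, hψ.1 b g hb, mul_add],
      fun g => (locAn J).add_mem (hφ.2 g) (hψ.2 g)⟩
  smul_mem' := fun t φ hφ =>
    ⟨fun b g hb => by simp [hφ.1 b g hb, mul_left_comm],
      fun g => (locAn J).smul_mem t (hφ.2 g)⟩

/-- The action of `G` on the induction by right translation, `(g φ)(x) = φ(x g)`. -/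
def indRep (χ₁ χ₂ : F →*₀ E) (J : Finset (F →ₐ[ℚ_[p]] E)) :
    Representation E (GL (Fin 2) F) (ind χ₁ χ₂ J) where
  toFun g :=
    { toFun := fun φ => ⟨fun x => φ.1 (x * g),
        fun b x hb => by simpa only [mul_assoc] using φ.2.1 b (x * g) hb,
        fun x => by simpa only [mul_assoc] using φ.2.2 (x * g)⟩
      map_add' := fun _ _ => rfl
      map_smul' := fun _ _ => rfl }
  map_one' := by ext φ x; simp
  map_mul' g h := by ext φ x; simp [mul_assoc]

/-- The restriction of `φ` along the chart `z ↦ [0, 1; -1, z]`. -/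
def restr₀ (χ₁ χ₂ : F →*₀ E) (J : Finset (F →ₐ[ℚ_[p]] E)) (φ : ind χ₁ χ₂ J) : locAn J :=
  ⟨fun z => φ.1 (chart₀ z), by simpa using φ.2.2 1⟩

/-- The restriction of `φ` along the chart `z ↦ [1, 0; z, -1]`. -/
def restr₁ (χ₁ χ₂ : F →*₀ E) (J : Finset (F →ₐ[ℚ_[p]] E)) (φ : ind χ₁ χ₂ J) : locAn J :=
  ⟨fun z => φ.1 (chart₁ z), by simpa only [chart₁_eq] using φ.2.2 _⟩

/-- The topology of the induction. The two charts `z ↦ [0, 1; -1, z]` and `z ↦ [1, 0; z, -1]`, with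
`z ∈ 𝒪_F`, cover `P \ G`; they embed the induction as a closed subspace of `𝓕(𝒪_F, J)²`. -/
@[reducible] def indTopology (χ₁ χ₂ : F →*₀ E) (J : Finset (F →ₐ[ℚ_[p]] E)) :
    TopologicalSpace (ind χ₁ χ₂ J) :=
  (locAnTopology J).induced (restr₀ χ₁ χ₂ J) ⊓ (locAnTopology J).induced (restr₁ χ₁ χ₂ J)

end Induced

section Algebraic

variable {p : ℕ} [Fact p.Prime]
variable {F : Type*} [NontriviallyNormedField F] [NormedAlgebra ℚ_[p] F]
variable {E : Type*} [NontriviallyNormedField E] [NormedAlgebra ℚ_[p] E]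

/-- `Symⁿ E²`: the homogeneous polynomials of degree `n` in the two variables `X₀, X₁`. -/
abbrev Sym (E : Type*) [NontriviallyNormedField E] (n : ℕ) : Type _ :=
  MvPolynomial.homogeneousSubmodule (Fin 2) E n

/-- The substitution `X_j ↦ ∑ᵢ σ(g_{ij}) Xᵢ`, that is, `P(X) ↦ P(X σ(g))` for the row vector
`X = (X₀, X₁)`. -/
def symAct (σ : F →ₐ[ℚ_[p]] E) (g : GL (Fin 2) F) :
    MvPolynomial (Fin 2) E →ₐ[E] MvPolynomial (Fin 2) E :=
  MvPolynomial.aeval fun j => ∑ i, MvPolynomial.C (σ (g i j)) * MvPolynomial.X i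

theorem symAct_mem (σ : F →ₐ[ℚ_[p]] E) (g : GL (Fin 2) F) (n : ℕ) :
    ∀ P ∈ MvPolynomial.homogeneousSubmodule (Fin 2) E n,
      (symAct σ g).toLinearMap P ∈ MvPolynomial.homogeneousSubmodule (Fin 2) E n := by
  intro P hP
  rw [MvPolynomial.mem_homogeneousSubmodule] at hP ⊢
  have := hP.aeval (fun j => ∑ i, MvPolynomial.C (σ (g i j)) * MvPolynomial.X i) (n := 1)
    (fun j => MvPolynomial.IsHomogeneous.sum _ _ _ fun i _ => by
      simpa using (MvPolynomial.isHomogeneous_C (Fin 2) (σ (g i j))).mul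
        (MvPolynomial.isHomogeneous_X E i))
  simpa [symAct] using this

theorem symAct_one (σ : F →ₐ[ℚ_[p]] E) : symAct σ 1 = AlgHom.id E _ := by
  ext j : 1
  fin_cases j <;> simp [symAct, Fin.sum_univ_two]

theorem symAct_mul (σ : F →ₐ[ℚ_[p]] E) (g h : GL (Fin 2) F) :
    symAct σ (g * h) = (symAct σ g).comp (symAct σ h) := by
  ext j : 1
  simp [symAct, Fin.sum_univ_two, Matrix.mul_apply]
  ring

/-- `(Symⁿ E²)^σ`: the group `G` acts on `Symⁿ E²` through `σ : G → GL₂(E)`. A diagonal matrix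
`diag(x₀, x₁)` acts on `X₀ⁱ X₁ⁿ⁻ⁱ` by `σ(x₀)ⁱ σ(x₁)ⁿ⁻ⁱ`. -/
def symRep (σ : F →ₐ[ℚ_[p]] E) (n : ℕ) : Representation E (GL (Fin 2) F) (Sym E n) where
  toFun g := (symAct σ g).toLinearMap.restrict (symAct_mem σ g n)
  map_one' := by
    ext P : 2
    simp [symAct_one]
  map_mul' g h := by
    ext P : 2
    simp [symAct_mul]

/-- The underlying space of `⨂_{σ ∈ S \ J} (Sym^{d_σ} E²)^σ`. -/
abbrev AlgSpace {J : Finset (F →ₐ[ℚ_[p]] E)} (d : {σ // σ ∉ J} → ℕ) : Type _ :=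
  ⨂[E] σ : {σ // σ ∉ J}, Sym E (d σ)

/-- The diagonal action of `G` on `⨂_{σ ∈ S \ J} (Sym^{d_σ} E²)^σ`. -/
def algRep {J : Finset (F →ₐ[ℚ_[p]] E)} (d : {σ // σ ∉ J} → ℕ) :
    Representation E (GL (Fin 2) F) (AlgSpace d) where
  toFun g := PiTensorProduct.map fun σ => symRep σ.1 (d σ) g
  map_one' := by simp only [map_one]; exact PiTensorProduct.map_one
  map_mul' g h := by simp only [map_mul]; exact PiTensorProduct.map_mul _ _

/-- The representation space
`I(χ, J, d) = (⨂_{σ ∈ S \ J} (Sym^{d_σ} E²)^σ) ⊗ (Ind_P^G χ₁ ⊗ χ₂)^{J-an}`. -/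
def LocAnRep (χ₁ χ₂ : F →*₀ E) {J : Finset (F →ₐ[ℚ_[p]] E)} (d : {σ // σ ∉ J} → ℕ) : Type _ :=
  AlgSpace d ⊗[E] ind χ₁ χ₂ J

variable (χ₁ χ₂ : F →*₀ E) {J : Finset (F →ₐ[ℚ_[p]] E)} (d : {σ // σ ∉ J} → ℕ)

instance : AddCommMonoid (LocAnRep χ₁ χ₂ d) :=
  inferInstanceAs (AddCommMonoid (AlgSpace d ⊗[E] ind χ₁ χ₂ J))

instance : Module E (LocAnRep χ₁ χ₂ d) :=
  inferInstanceAs (Module E (AlgSpace d ⊗[E] ind χ₁ χ₂ J))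

instance : AddCommGroup (LocAnRep χ₁ χ₂ d) :=
  Module.addCommMonoidToAddCommGroup E

/-- The contraction `l ⊗ id : W ⊗ Ind → Ind` with a linear form `l` on the algebraic factor `W`. -/
def contract (l : Module.Dual E (AlgSpace d)) : LocAnRep χ₁ χ₂ d →ₗ[E] ind χ₁ χ₂ J :=
  (TensorProduct.lid E (ind χ₁ χ₂ J)).toLinearMap ∘ₗ LinearMap.rTensor (ind χ₁ χ₂ J) l

/-- The topology of `W ⊗ Ind` with `W` of finite dimension: the product topology of `Ind^{dim W}`
for any choice of a basis of `W`. -/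
instance : TopologicalSpace (LocAnRep χ₁ χ₂ d) :=
  ⨅ l : Module.Dual E (AlgSpace d), (indTopology χ₁ χ₂ J).induced (contract χ₁ χ₂ d l)

/-- The (diagonal) action of `G` on `I(χ, J, d)`. -/
def locAnRep : Representation E (GL (Fin 2) F) (LocAnRep χ₁ χ₂ d) :=
  (algRep d).tprod (indRep χ₁ χ₂ J)

/-- `|d| = ∑_{σ ∈ S \ J} d_σ`. -/
def totalWeight : ℕ := ∑ᶠ σ, d σ

end Algebraic

section Completion

universe u v w t

variable {E : Type u} [NontriviallyNormedField E] {G : Type v} [Group G] [TopologicalSpace G]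

/-- An action of `G` on the Banach space `B` makes it a unitary `G`-Banach space (for the given,
invariant, choice of the norm): it is continuous as a map `G × B → B`, and isometric. -/
structure IsUnitaryBanachRep {B : Type*} [NormedAddCommGroup B] [NormedSpace E B]
    (ρ : Representation E G B) : Prop where
  continuous_action : Continuous fun x : G × B => ρ x.1 x.2
  norm_map : ∀ g v, ‖ρ g v‖ = ‖v‖

/-- `(B, ι)` is a universal unitary completion of the topological representation `ρV` of `G`:
`B` is a unitary `G`-Banach space, `ι : V → B` is `E`-linear, continuous and `G`-equivariant, and
every `E`-linear, continuous, `G`-equivariant map from `V` to a unitary `G`-Banach space factors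
uniquely through `ι`. Banach spaces are complete with respect to a non-archimedean norm. -/
structure IsUniversalUnitaryCompletion {V : Type w} [AddCommGroup V] [Module E V]
    [TopologicalSpace V] (ρV : Representation E G V)
    {B : Type t} [NormedAddCommGroup B] [NormedSpace E B] [CompleteSpace B] [IsUltrametricDist B]
    (ρB : Representation E G B) (ι : V →L[E] B) : Prop where
  unitary : IsUnitaryBanachRep ρB
  equivariant : ∀ g v, ι (ρV g v) = ρB g (ι v)
  universal : ∀ (W : Type t) [NormedAddCommGroup W] [NormedSpace E W] [CompleteSpace W]
    [IsUltrametricDist W] (ρW : Representation E G W), IsUnitaryBanachRep ρW →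
    ∀ φ : V →L[E] W, (∀ g v, φ (ρV g v) = ρW g (φ v)) →
      ∃! ψ : B →L[E] W, (∀ g b, ψ (ρB g b) = ρW g (ψ b)) ∧ ∀ v, ψ (ι v) = φ v

end Completion

/-- The valuation `val_{ℚ_p}` on a finite extension of `ℚ_[p]`, normalised by `val p = 1`. -/
def val (p : ℕ) {E : Type*} [NontriviallyNormedField E] (x : E) : ℝ := -Real.logb p ‖x‖

end PadicGL2

end

namespace PadicGL2

/-! ### Analytic expansions on discs of `𝒪_F`: recentring, compactness, rescaling. -/

section Analytic

variable {p : ℕ} [Fact p.Prime]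
variable {F : Type*} [NontriviallyNormedField F] [NormedAlgebra ℚ_[p] F]
variable {E : Type*} [NontriviallyNormedField E] [NormedAlgebra ℚ_[p] E]

/-! If the completion `B` is nonzero then `ι ≠ 0`: otherwise both `0` and the identity of `B` would
factor `ι` through itself. The centre acts on the source by a scalar `ω(z)` and on `B` by
isometries, so `‖ω(z)‖ = 1`. Every embedding fixes `p`, so the case `z = p` is the valuation
identity. Given that identity, (ii) amounts to `‖χ₁(p)‖ ≥ 1`, and the real content is that `‖χ₁(p)‖
< 1` forces `ι = 0` (`map_eq_zero_of_norm_lt_one`).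

Let `w` be a pure tensor of integral polynomials and `φ` a function supported on the cell `P *
chart₀ 𝒪_F`. Cut `𝒪_F` into the discs `a + pᴺ⁺¹ 𝒪_F`. The matrix `[1, -a; 0, pᴺ]` carries the piece
of `φ` on such a disc to `p 𝒪_F`, at the price of a factor `χ₁(p)ᴺ` (`chart₀_mul_upper`). For large
`N` the rescaled functions stay in one ball of `𝓕_1` (`NormLE.rescale`). The matrix has integral
entries, so it keeps `w` integral (`symAct_mem_integralPoly`). A continuous map is bounded on all
such tensors by a single constant `D` (`exists_bound_tmul`). As `G` acts isometrically and the norm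
of `B` is ultrametric, the number of discs is irrelevant, and `‖ι(w ⊗ φ)‖ ≤ ‖χ₁(p)‖ᴺ |D|` tends to
`0`. Scaling removes the integrality of `w`, and the matrix `[0, 1; 1, 0]` deals with functions
supported off the cell. -/

theorem radius_pos (p h : ℕ) [Fact p.Prime] : 0 < radius p h := by
  have : (0 : ℝ) < p := by exact_mod_cast (Fact.out : p.Prime).pos
  unfold radius
  positivity

theorem norm_natCast_prime (p : ℕ) [Fact p.Prime] (F : Type*) [NontriviallyNormedField F]
    [NormedAlgebra ℚ_[p] F] : ‖(p : F)‖ = (p : ℝ)⁻¹ := by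
  rw [← map_natCast (algebraMap ℚ_[p] F) p, norm_algebraMap', Padic.norm_p]

theorem norm_natCast_prime_pow (p : ℕ) [Fact p.Prime] (F : Type*) [NontriviallyNormedField F]
    [NormedAlgebra ℚ_[p] F] (n : ℕ) : ‖(p : F) ^ n‖ = radius p n := by
  rw [norm_pow, norm_natCast_prime, radius]

theorem natCast_prime_ne_zero (p : ℕ) [Fact p.Prime] (F : Type*) [NontriviallyNormedField F]
    [NormedAlgebra ℚ_[p] F] : (p : F) ≠ 0 := by
  rw [← norm_ne_zero_iff, norm_natCast_prime]
  exact inv_ne_zero (by exact_mod_cast (Fact.out : p.Prime).ne_zero)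

/-- A linear map on a finite-dimensional space is bounded. Applying that bound to the powers `xⁿ` of
a vector expanded by `σ` would make `(‖σ x‖ / ‖x‖)ⁿ` bounded, which is absurd. -/
theorem norm_algHom_le [FiniteDimensional ℚ_[p] F] (σ : F →ₐ[ℚ_[p]] E) (x : F) :
    ‖σ x‖ ≤ ‖x‖ := by
  by_contra! hlt
  have hx : 0 < ‖x‖ := norm_pos_iff.2 fun h => by simp [h] at hlt
  set T : F →L[ℚ_[p]] E := LinearMap.toContinuousLinearMap σ.toLinearMap
  have hT : ∀ y, ‖σ y‖ ≤ ‖T‖ * ‖y‖ := fun y => T.le_opNorm y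
  have hr : 1 < ‖σ x‖ / ‖x‖ := (one_lt_div hx).2 hlt
  obtain ⟨n, hn⟩ := pow_unbounded_of_one_lt ‖T‖ hr
  have := hT (x ^ n)
  rw [map_pow, norm_pow, norm_pow] at this
  rw [div_pow, lt_div_iff₀ (by positivity)] at hn
  linarith

theorem norm_prod_algHom_pow_le [FiniteDimensional ℚ_[p] F] {J : Finset (F →ₐ[ℚ_[p]] E)}
    {x : F} {r : ℝ} (hx : ‖x‖ ≤ r) (m : J → ℕ) :
    ‖∏ σ : J, σ.1 x ^ m σ‖ ≤ r ^ (∑ σ, m σ) := by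
  rw [norm_prod, ← Finset.prod_pow_eq_pow_sum]
  refine Finset.prod_le_prod (fun _ _ => norm_nonneg _) fun σ _ => ?_
  rw [norm_pow]
  exact pow_le_pow_left₀ (norm_nonneg _) ((norm_algHom_le σ.1 x).trans hx) _

/-- The binomial theorem in several variables, indexed by all `k` so that it can serve as a row of a
double series: terms with `k ≰ m` vanish because a binomial coefficient does. -/
theorem prod_algHom_add_pow {J : Finset (F →ₐ[ℚ_[p]] E)} (x y : F) (m : J → ℕ) :
    HasSum (fun k : J → ℕ => (∏ σ : J, σ.1 x ^ k σ) *
      ∏ σ : J, (σ.1 y ^ (m σ - k σ) * ((m σ).choose (k σ) : E)))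
      (∏ σ : J, σ.1 (x + y) ^ m σ) := by
  classical
  simp only [map_add, add_pow, Finset.prod_univ_sum, ← Finset.prod_mul_distrib, mul_assoc]
  refine hasSum_sum_of_ne_finset_zero fun k hk => ?_
  simp only [Fintype.mem_piFinset, Finset.mem_range, not_forall, not_lt] at hk
  obtain ⟨σ, hσ⟩ := hk
  exact Finset.prod_eq_zero (Finset.mem_univ σ) (by simp [Nat.choose_eq_zero_of_lt hσ])

-- Binomial coefficients have norm at most `1` in an ultrametric field, so recentring a monomial
-- inside its disc costs nothing.
open Classical in
theorem norm_binomial_prod_mul_le [FiniteDimensional ℚ_[p] F] [IsUltrametricDist E]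
    {J : Finset (F →ₐ[ℚ_[p]] E)} {y : F} {r : ℝ} (hy : ‖y‖ ≤ r) (m k : J → ℕ) :
    ‖∏ σ : J, (σ.1 y ^ (m σ - k σ) * ((m σ).choose (k σ) : E))‖ * r ^ (∑ σ, k σ) ≤
      if k ≤ m then r ^ (∑ σ, m σ) else 0 := by
  have hr : 0 ≤ r := (norm_nonneg y).trans hy
  split_ifs with hkm
  · have h1 := norm_prod_algHom_pow_le (E := E) hy (m - k)
    have h2 : ‖∏ σ : J, ((m σ).choose (k σ) : E)‖ ≤ 1 := by
      rw [norm_prod]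
      exact Finset.prod_le_one (fun _ _ => norm_nonneg _)
        fun σ _ => IsUltrametricDist.norm_natCast_le_one E _
    rw [Finset.prod_mul_distrib, norm_mul]
    have h3 : ∑ σ, m σ = ∑ σ, (m - k) σ + ∑ σ, k σ := by
      rw [← Finset.sum_add_distrib]
      exact Finset.sum_congr rfl fun σ _ => by simp [Nat.sub_add_cancel (hkm σ)]
    rw [h3, pow_add]
    refine mul_le_mul_of_nonneg_right ?_ (by positivity)
    calc _ ≤ r ^ (∑ σ, (m - k) σ) * 1 :=
          mul_le_mul h1 h2 (norm_nonneg _) (by positivity)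
      _ = _ := mul_one _
  · obtain ⟨σ, hσ⟩ : ∃ σ, m σ < k σ := by simpa [Pi.le_def] using hkm
    rw [Finset.prod_eq_zero (Finset.mem_univ σ) (by simp [Nat.choose_eq_zero_of_lt hσ])]
    simp

/-- A convergent expansion on a disc can be recentred at any point of the disc, without enlarging
the norm of its coefficients. -/
theorem IsDiscExpansion.recenter [FiniteDimensional ℚ_[p] F] [IsUltrametricDist E]
    [CompleteSpace E] {J : Finset (F →ₐ[ℚ_[p]] E)} {X : Set F} {f : X → E} {a b : F} {h : ℕ}
    {c : (J → ℕ) → E} (H : IsDiscExpansion J X f a h c) (hab : ‖b - a‖ ≤ radius p h) {C : ℝ}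
    (hC : ∀ m, ‖c m‖ * radius p h ^ (∑ σ, m σ) ≤ C) :
    ∃ e, IsDiscExpansion J X f b h e ∧ ∀ m, ‖e m‖ * radius p h ^ (∑ σ, m σ) ≤ C := by
  classical
  have : IsUltrametricDist F := IsUltrametricDist.of_normedAlgebra ℚ_[p]
  set r := radius p h with hrdef
  have hr : 0 < r := radius_pos p h
  have hC0 : 0 ≤ C := (mul_nonneg (norm_nonneg _) (pow_nonneg hr.le _)).trans (hC 0)
  -- `t m k` is the contribution of the `m`-th old term to the `k`-th new coefficient.
  set t : (J → ℕ) → (J → ℕ) → E := fun m k =>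
    c m * ∏ σ : J, (σ.1 (b - a) ^ (m σ - k σ) * ((m σ).choose (k σ) : E)) with ht
  have hbd : ∀ m k, ‖t m k‖ * r ^ (∑ σ, k σ) ≤
      if k ≤ m then ‖c m‖ * r ^ (∑ σ, m σ) else 0 := by
    intro m k
    have := mul_le_mul_of_nonneg_left (norm_binomial_prod_mul_le (E := E) hab m k)
      (norm_nonneg (c m))
    rw [mul_ite, mul_zero, ← mul_assoc, ← norm_mul] at this
    exact this
  have hfin : ∀ ε > 0, ({m | ε ≤ ‖c m‖ * r ^ (∑ σ, m σ)} : Set (J → ℕ)).Finite := by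
    intro ε hε
    have := H.1.eventually (gt_mem_nhds hε)
    rw [Filter.eventually_cofinite] at this
    simpa using this
  have hlarge : ∀ ε > 0, ∀ m k, ε ≤ ‖t m k‖ * r ^ (∑ σ, k σ) →
      k ≤ m ∧ ε ≤ ‖c m‖ * r ^ (∑ σ, m σ) := by
    intro ε hε m k hle
    have := hle.trans (hbd m k)
    split_ifs at this with hkm
    · exact ⟨hkm, this⟩
    · exact absurd this (not_le.2 hε)
  have hsum : ∀ k, Summable fun m => t m k := by
    intro k
    refine NonarchimedeanAddGroup.summable_of_tendsto_cofinite_zero ?_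
    rw [tendsto_zero_iff_norm_tendsto_zero]
    have h0 : Filter.Tendsto (fun m => ‖t m k‖ * r ^ (∑ σ, k σ)) Filter.cofinite (nhds 0) := by
      refine squeeze_zero (fun m => by positivity) (fun m => (hbd m k).trans ?_) H.1
      split_ifs
      · exact le_rfl
      · positivity
    have h1 := h0.div_const (r ^ (∑ σ, k σ))
    have hne : r ^ (∑ σ, k σ) ≠ 0 := by positivity
    simpa only [mul_div_cancel_right₀ _ hne, zero_div] using h1
  refine ⟨fun k => ∑' m, t m k, ⟨?_, fun z hz => ?_⟩, fun k => ?_⟩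
  · rw [Metric.tendsto_nhds]
    intro ε hε
    rw [Filter.eventually_cofinite]
    -- A large new coefficient at `k` needs a large old one at some `m ≥ k`; there are finitely many
    -- such `m`, hence finitely many `k`. Passing to `ε / 2` restores the strict inequality lost in
    -- the supremum.
    refine (((hfin (ε / 2) (half_pos hε)).biUnion fun m _ => Set.finite_Iic m)).subset ?_
    intro k hk
    simp only [Set.mem_ofPred_eq, not_lt, dist_zero_right] at hk
    rw [Real.norm_of_nonneg (by positivity)] at hk
    by_contra hno
    simp only [Set.mem_iUnion, Set.mem_Iic, not_exists] at hno
    have : ‖∑' m, t m k‖ ≤ ε / 2 / r ^ (∑ σ, k σ) := by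
      refine IsUltrametricDist.norm_tsum_le_of_forall_le fun m => ?_
      rw [le_div_iff₀ (by positivity)]
      by_contra! hlt
      obtain ⟨h1, h2⟩ := hlarge _ (half_pos hε) m k hlt.le
      exact hno m h2 h1
    rw [le_div_iff₀ (by positivity)] at this
    linarith
  · have hza : ‖(z : F) - a‖ ≤ r := by
      have := IsUltrametricDist.norm_add_le_max ((z : F) - b) (b - a)
      rw [sub_add_sub_cancel] at this
      exact this.trans (max_le hz hab)
    -- Summing this double series along `k` first recovers `f z`; along `m` first it gives the new
    -- expansion.
    set G : (J → ℕ) × (J → ℕ) → E := fun q => t q.1 q.2 * ∏ σ : J, σ.1 ((z : F) - b) ^ q.2 σ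
    have hG : Summable G := by
      refine NonarchimedeanAddGroup.summable_of_tendsto_cofinite_zero ?_
      rw [Metric.tendsto_nhds]
      intro ε hε
      rw [Filter.eventually_cofinite]
      refine (((hfin ε hε).biUnion fun m _ =>
        (Set.finite_singleton m).prod (Set.finite_Iic m))).subset ?_
      rintro ⟨m, k⟩ hq
      simp only [Set.mem_ofPred_eq, not_lt, dist_zero_right, G, norm_mul] at hq
      have h1 := hq.trans (mul_le_mul_of_nonneg_left
        (norm_prod_algHom_pow_le (E := E) hz k) (norm_nonneg _))
      obtain ⟨h2, h3⟩ := hlarge ε hε m k h1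
      simp only [Set.mem_iUnion]
      exact ⟨m, h3, by simpa using h2⟩
    have hrow : ∀ m, HasSum (fun k => G (m, k)) (c m * ∏ σ : J, σ.1 ((z : F) - a) ^ m σ) := by
      intro m
      have := (prod_algHom_add_pow (E := E) ((z : F) - b) (b - a) m).mul_left (c m)
      rw [sub_add_sub_cancel] at this
      refine this.congr_fun fun k => ?_
      simp only [G, ht]
      ring
    have h1 := hG.hasSum.prod_fiberwise hrow
    rw [(H.2 z hza).unique h1]
    have h2 : HasSum (fun q : (J → ℕ) × (J → ℕ) => G (q.2, q.1)) (∑' q, G q) :=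
      (Equiv.hasSum_iff (f := G) (Equiv.prodComm _ _)).2 hG.hasSum
    exact HasSum.prod_fiberwise h2 fun k =>
      (hsum k).hasSum.mul_right (∏ σ : J, σ.1 ((z : F) - b) ^ k σ)
  · have : ‖∑' m, t m k‖ ≤ C / r ^ (∑ σ, k σ) := by
      refine IsUltrametricDist.norm_tsum_le_of_forall_le fun m => ?_
      rw [le_div_iff₀ (by positivity)]
      refine (hbd m k).trans ?_
      split_ifs
      · exact hC m
      · exact hC0
    rwa [le_div_iff₀ (by positivity)] at this

/-- A finite set of representatives of `𝒪_F` modulo `pⁿ`. -/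
theorem exists_finset_representatives (p : ℕ) [Fact p.Prime] (F : Type*)
    [NontriviallyNormedField F] [NormedAlgebra ℚ_[p] F] [FiniteDimensional ℚ_[p] F] (n : ℕ) :
    ∃ T : Finset F, (∀ t ∈ T, ‖t‖ ≤ 1) ∧
      ∀ z : F, ‖z‖ ≤ 1 → ∃! t, t ∈ T ∧ ‖z - t‖ ≤ radius p n := by
  classical
  have : IsUltrametricDist F := IsUltrametricDist.of_normedAlgebra ℚ_[p]
  have : ProperSpace F := FiniteDimensional.proper ℚ_[p] F
  -- Lying in a common disc is an equivalence relation by ultrametricity, with finitely many classes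
  -- by compactness; one point per class yields existence and uniqueness.
  let s : Setoid (intSet F) :=
    { r := fun x y => ‖(x : F) - y‖ ≤ radius p n
      iseqv :=
        { refl := fun x => by simpa using radius_nonneg p n
          symm := fun {x y} h => by rwa [norm_sub_rev]
          trans := fun {x y z} hxy hyz => by
            have := IsUltrametricDist.norm_add_le_max ((x : F) - y) ((y : F) - z)
            rw [sub_add_sub_cancel] at this
            exact this.trans (max_le hxy hyz) } }
  have hcpt : IsCompact (intSet F) := by
    have : intSet F = Metric.closedBall 0 1 := by ext; simp [intSet]
    rw [this]
    exact isCompact_closedBall _ _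
  obtain ⟨S, hS, hSfin, hcov⟩ := hcpt.finite_cover_balls (radius_pos p n)
  have : Finite (Quotient s) := by
    have : Finite S := hSfin
    refine Finite.of_surjective (fun x : S => Quotient.mk s ⟨x, hS x.2⟩) fun q => ?_
    induction q using Quotient.inductionOn with
    | h z =>
      have := hcov z.2
      simp only [Set.mem_iUnion] at this
      obtain ⟨x, hx, hzx⟩ := this
      refine ⟨⟨x, hx⟩, Quotient.sound ?_⟩
      change ‖x - (z : F)‖ ≤ _
      rw [norm_sub_rev, ← dist_eq_norm]
      exact (Metric.mem_ball.1 hzx).le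
  have := Fintype.ofFinite (Quotient s)
  refine ⟨Finset.univ.image fun q : Quotient s => (q.out : F), ?_, fun z hz => ?_⟩
  · intro t ht
    obtain ⟨q, -, rfl⟩ := Finset.mem_image.1 ht
    exact q.out.2
  · refine ⟨((Quotient.mk s ⟨z, hz⟩).out : F), ⟨Finset.mem_image_of_mem _ (Finset.mem_univ _), ?_⟩,
      ?_⟩
    · rw [norm_sub_rev]
      exact Quotient.exact (Quotient.out_eq (Quotient.mk s ⟨z, hz⟩))
    · rintro t ⟨ht, hzt⟩
      obtain ⟨q, -, rfl⟩ := Finset.mem_image.1 ht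
      have : Quotient.mk s ⟨z, hz⟩ = Quotient.mk s q.out := Quotient.sound hzt
      rw [this, Quotient.out_eq]

/-- A locally analytic function on the compact set `𝒪_F` lies in a ball of one of the `𝓕_h`. -/
theorem exists_normLE [FiniteDimensional ℚ_[p] F] [IsUltrametricDist E] [CompleteSpace E]
    {J : Finset (F →ₐ[ℚ_[p]] E)} {f : intSet F → E} (hf : f ∈ locAn J) :
    ∃ (h : ℕ) (C : ℝ), NormLE J h f C := by
  obtain ⟨h, hf⟩ := hf
  choose c hc using hf
  have hbd : ∀ a : intSet F, ∃ C : ℝ, ∀ m, ‖c a m‖ * radius p h ^ (∑ σ, m σ) ≤ C := by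
    intro a
    obtain ⟨C, hC⟩ := (hc a).1.bddAbove_range_of_cofinite
    exact ⟨C, fun m => hC ⟨m, rfl⟩⟩
  choose C hC using hbd
  obtain ⟨T, hT, hcov⟩ := exists_finset_representatives p F h
  refine ⟨h, ∑ t ∈ T.attach, |C ⟨t, hT t t.2⟩|, fun a => ?_⟩
  obtain ⟨t, ⟨ht, hat⟩, -⟩ := hcov a a.2
  -- Every disc is that of a representative, so the sum of finitely many bounds serves for all
  -- centres.
  refine (hc ⟨t, hT t ht⟩).recenter hat fun m => (hC _ m).trans ((le_abs_self _).trans ?_)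
  exact Finset.single_le_sum (f := fun t : T => |C ⟨t, hT t t.2⟩|) (fun _ _ => abs_nonneg _)
    (Finset.mem_attach T ⟨t, ht⟩)

theorem NormLE.nonneg {J : Finset (F →ₐ[ℚ_[p]] E)} {h : ℕ} {f : intSet F → E} {B : ℝ}
    (H : NormLE J h f B) : 0 ≤ B := by
  obtain ⟨c, -, hB⟩ := H ⟨0, by simp [intSet]⟩
  exact (mul_nonneg (norm_nonneg _) (pow_nonneg (radius_nonneg p h) _)).trans (hB 0)

open Classical in
/-- Cutting off by a set that is a union of discs of a fixed radius preserves local analyticity. -/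
theorem ite_mem_locAn {J : Finset (F →ₐ[ℚ_[p]] E)} {f : intSet F → E} (hf : f ∈ locAn J)
    (A : intSet F → Prop) (k : ℕ)
    (hA : ∀ x y : intSet F, ‖(y : F) - x‖ ≤ radius p k → (A x ↔ A y)) :
    (fun z => if A z then f z else 0) ∈ locAn J := by
  obtain ⟨h, hf⟩ := hf
  refine ⟨max h k, fun a => ?_⟩
  by_cases ha : A a
  · obtain ⟨c, hc⟩ := hf a
    have hc' := hc.mono (le_max_left h k)
    refine ⟨c, hc'.1, fun z hz => ?_⟩
    beta_reduce
    rw [if_pos ((hA a z (hz.trans (radius_anti (le_max_right h k)))).1 ha)]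
    exact hc'.2 z hz
  · have h0 := IsDiscExpansion.zero (E := E) J (intSet F) a (max h k)
    refine ⟨0, h0.1, fun z hz => ?_⟩
    beta_reduce
    rw [if_neg (fun h' => ha ((hA a z (hz.trans (radius_anti (le_max_right h k)))).2 h'))]
    exact h0.2 z hz

/-- The rescaling of `f` on the disc `a + pᴺ⁺¹ 𝒪_F` to the disc `p 𝒪_F`, extended by zero. -/
theorem NormLE.rescale {J : Finset (F →ₐ[ℚ_[p]] E)} {h N : ℕ} {f : intSet F → E} {B : ℝ}
    (H : NormLE J h f B) (hN : h ≤ N + 1) (g : intSet F → E) (a : F) (ha : ‖a‖ ≤ 1)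
    (hg₀ : ∀ z : intSet F, ¬ ‖(z : F)‖ ≤ radius p 1 → g z = 0)
    (hg₁ : ∀ z w : intSet F, ‖(z : F)‖ ≤ radius p 1 → (w : F) = a + (p : F) ^ N * z →
      g z = f w) : NormLE J 1 g B := by
  have : IsUltrametricDist F := IsUltrametricDist.of_normedAlgebra ℚ_[p]
  have hr1 : radius p N ≤ 1 := by simpa [radius] using radius_anti (p := p) (Nat.zero_le N)
  have hmem : ∀ z : intSet F, ‖a + (p : F) ^ N * z‖ ≤ 1 := fun z => by
    refine (IsUltrametricDist.norm_add_le_max _ _).trans (max_le ha ?_)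
    rw [norm_mul, norm_natCast_prime_pow]
    exact mul_le_one₀ hr1 (norm_nonneg _) z.2
  intro b
  by_cases hb : ‖(b : F)‖ ≤ radius p 1
  · obtain ⟨c, hc, hcB⟩ := H ⟨_, hmem b⟩
    have hle : ∀ m : J → ℕ, ‖c m * ((p : E) ^ N) ^ (∑ σ, m σ)‖ * radius p 1 ^ (∑ σ, m σ) ≤
        ‖c m‖ * radius p h ^ (∑ σ, m σ) := by
      intro m
      rw [norm_mul, norm_pow, norm_natCast_prime_pow, mul_assoc, ← mul_pow]
      have : radius p N * radius p 1 = radius p (N + 1) := by simp [radius, pow_succ]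
      rw [this]
      exact mul_le_mul_of_nonneg_left
        (pow_le_pow_left₀ (radius_nonneg _ _) (radius_anti hN) _) (norm_nonneg _)
    -- Substituting `z ↦ a + pᴺ z` multiplies the `m`-th coefficient by `p^(N |m|)`, since `σ(p) =
    -- p`.
    refine ⟨fun m => c m * ((p : E) ^ N) ^ (∑ σ, m σ), ⟨squeeze_zero (fun m => ?_) hle hc.1,
      fun z hz => ?_⟩, fun m => (hle m).trans (hcB m)⟩
    · exact mul_nonneg (norm_nonneg _) (pow_nonneg (radius_nonneg p 1) _)
    · have hz1 : ‖(z : F)‖ ≤ radius p 1 := by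
        have := IsUltrametricDist.norm_add_le_max ((z : F) - b) b
        rw [sub_add_cancel] at this
        exact this.trans (max_le hz hb)
      rw [hg₁ z ⟨_, hmem z⟩ hz1 rfl]
      have hdiff : a + (p : F) ^ N * z - (a + (p : F) ^ N * b) = (p : F) ^ N * ((z : F) - b) := by
        ring
      have := hc.2 ⟨_, hmem z⟩ (by
        simp only [hdiff, norm_mul, norm_natCast_prime_pow]
        refine le_trans ?_ (radius_anti hN)
        rw [show radius p (N + 1) = radius p N * radius p 1 by simp [radius, pow_succ]]
        exact mul_le_mul_of_nonneg_left hz (radius_nonneg _ _))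
      refine this.congr_fun fun m => ?_
      simp only [hdiff, map_mul, map_pow, map_natCast, mul_pow, Finset.prod_mul_distrib,
        Finset.prod_pow_eq_pow_sum]
      ring
  · have h0 := IsDiscExpansion.zero (E := E) J (intSet F) b 1
    refine ⟨0, ⟨h0.1, fun z hz => ?_⟩, fun m => by simpa using H.nonneg⟩
    rw [hg₀ z fun hz1 => hb ?_]
    · exact h0.2 z hz
    · have := IsUltrametricDist.norm_add_le_max (z : F) ((b : F) - z)
      rw [add_sub_cancel, norm_sub_rev (b : F)] at this
      exact this.trans (max_le hz1 hz)

end Analytic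

/-! ### Integral polynomials, the central character, and boundedness on pure tensors. -/

section Algebraic

variable {p : ℕ} [Fact p.Prime]
variable {F : Type*} [NontriviallyNormedField F] [NormedAlgebra ℚ_[p] F]
variable {E : Type*} [NontriviallyNormedField E] [NormedAlgebra ℚ_[p] E]

/-- The polynomials in `X₀, X₁` with coefficients in `𝒪_E`. -/
def integralPoly (E : Type*) [NontriviallyNormedField E] [IsUltrametricDist E] :
    Subring (MvPolynomial (Fin 2) E) where
  carrier := {P | ∀ m, ‖P.coeff m‖ ≤ 1}
  zero_mem' := by simp
  one_mem' := fun m => by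
    classical
    rw [MvPolynomial.coeff_one]
    split_ifs <;> simp
  add_mem' := fun {P Q} hP hQ m => by
    rw [MvPolynomial.coeff_add]
    exact (IsUltrametricDist.norm_add_le_max _ _).trans (max_le (hP m) (hQ m))
  neg_mem' := fun {P} hP m => by simpa using hP m
  mul_mem' := fun {P Q} hP hQ m => by
    classical
    rw [MvPolynomial.coeff_mul]
    refine IsUltrametricDist.norm_sum_le_of_forall_le_of_nonneg zero_le_one fun x _ => ?_
    rw [norm_mul]
    exact mul_le_one₀ (hP _) (norm_nonneg _) (hQ _)

theorem C_mem_integralPoly [IsUltrametricDist E] {x : E} (hx : ‖x‖ ≤ 1) :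
    MvPolynomial.C x ∈ integralPoly E := fun m => by
  classical
  rw [MvPolynomial.coeff_C]
  split_ifs <;> simp [hx]

theorem X_mem_integralPoly [IsUltrametricDist E] (i : Fin 2) :
    MvPolynomial.X i ∈ integralPoly E := fun m => by
  classical
  rw [MvPolynomial.coeff_X]
  split_ifs <;> simp

theorem exists_smul_mem_integralPoly (p : ℕ) [Fact p.Prime] [NormedAlgebra ℚ_[p] E]
    [IsUltrametricDist E] (P : MvPolynomial (Fin 2) E) : ∃ t : E, t ≠ 0 ∧ t • P ∈ integralPoly E := by
  set S := ∑ m ∈ P.support, ‖P.coeff m‖ with hS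
  have hS0 : 0 ≤ S := Finset.sum_nonneg fun _ _ => norm_nonneg _
  have hp : ((p : ℝ)⁻¹) < 1 := inv_lt_one_of_one_lt₀
    (by exact_mod_cast (Fact.out : p.Prime).one_lt)
  obtain ⟨n, hn⟩ := exists_pow_lt_of_lt_one (show 0 < (S + 1)⁻¹ by positivity) hp
  refine ⟨(p : E) ^ n, pow_ne_zero _ (natCast_prime_ne_zero p E), fun m => ?_⟩
  rw [MvPolynomial.coeff_smul, norm_smul, norm_natCast_prime_pow, radius]
  have hm : ‖P.coeff m‖ ≤ S := by
    by_cases h : m ∈ P.support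
    · exact Finset.single_le_sum (f := fun m => ‖P.coeff m‖) (fun _ _ => norm_nonneg _) h
    · rw [MvPolynomial.notMem_support_iff.1 h, norm_zero]
      exact hS0
  calc _ ≤ (S + 1)⁻¹ * (S + 1) :=
        mul_le_mul hn.le (hm.trans (by linarith)) (norm_nonneg _) (by positivity)
    _ = 1 := inv_mul_cancel₀ (by positivity)

/-- Embeddings do not increase norms, so `g` substitutes integral linear forms for the variables. -/
theorem symAct_mem_integralPoly [FiniteDimensional ℚ_[p] F] [IsUltrametricDist E]
    (σ : F →ₐ[ℚ_[p]] E) {g : GL (Fin 2) F} (hg : ∀ i j, ‖g i j‖ ≤ 1)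
    {P : MvPolynomial (Fin 2) E} (hP : P ∈ integralPoly E) : symAct σ g P ∈ integralPoly E := by
  rw [symAct, MvPolynomial.aeval_def, MvPolynomial.eval₂_eq']
  refine Subring.sum_mem _ fun m _ => Subring.mul_mem _ (C_mem_integralPoly (hP m))
    (Subring.prod_mem _ fun i _ => Subring.pow_mem _ (Subring.sum_mem _ fun j _ =>
      Subring.mul_mem _ (C_mem_integralPoly ((norm_algHom_le σ _).trans (hg j i)))
        (X_mem_integralPoly j)) _)

open Classical in
/-- The monomial `X₀^{m₀} X₁^{m₁}` as an element of `Symⁿ E²` (zero if it is not of degree `n`). -/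
noncomputable def symMonomial (E : Type*) [NontriviallyNormedField E] (n : ℕ) (m : Fin 2 →₀ ℕ) : Sym E n :=
  if h : m.degree = n then ⟨MvPolynomial.monomial m 1, MvPolynomial.isHomogeneous_monomial _ h⟩
  else 0

theorem degree_eq_of_coeff_ne_zero {n : ℕ} (P : Sym E n) {m : Fin 2 →₀ ℕ}
    (hm : P.1.coeff m ≠ 0) : m.degree = n := by
  rw [Finsupp.degree_eq_weight_one]
  exact P.2 hm

theorem eq_sum_symMonomial {n : ℕ} (P : Sym E n) :
    P = ∑ m ∈ Finset.finsuppAntidiag Finset.univ n, P.1.coeff m • symMonomial E n m := by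
  apply Subtype.ext
  conv_lhs => rw [P.1.as_sum]
  rw [Submodule.coe_sum]
  refine Finset.sum_subset_zero_on_sdiff (fun m hm => ?_) (fun m hm => ?_) fun m hm => ?_
  · rw [Finset.mem_finsuppAntidiag]
    refine ⟨?_, Finset.subset_univ _⟩
    rw [← Finsupp.degree_eq_sum]
    exact degree_eq_of_coeff_ne_zero P (MvPolynomial.mem_support_iff.1 hm)
  · have : P.1.coeff m = 0 := MvPolynomial.notMem_support_iff.1 (Finset.mem_sdiff.1 hm).2
    simp [this]
  · rw [symMonomial, dif_pos (degree_eq_of_coeff_ne_zero P (MvPolynomial.mem_support_iff.1 hm))]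
    simp [MvPolynomial.smul_monomial]

/-- A multilinear form is bounded on the families of integral polynomials. -/
theorem exists_bound_multilinear [IsUltrametricDist E] {S : Type*} [Finite S] {d : S → ℕ}
    (f : MultilinearMap E (fun s => Sym E (d s)) E) :
    ∃ D : ℝ, ∀ P : ∀ s, Sym E (d s), (∀ s, (P s).1 ∈ integralPoly E) → ‖f P‖ ≤ D := by
  classical
  have := Fintype.ofFinite S
  refine ⟨∑ r ∈ Fintype.piFinset fun s => Finset.finsuppAntidiag Finset.univ (d s),
    ‖f fun s => symMonomial E (d s) (r s)‖, fun P hP => ?_⟩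
  have : P = fun s => ∑ m ∈ Finset.finsuppAntidiag Finset.univ (d s),
      (P s).1.coeff m • symMonomial E (d s) m := funext fun s => eq_sum_symMonomial (P s)
  rw [this, f.map_sum_finset]
  refine (norm_sum_le _ _).trans (Finset.sum_le_sum fun r _ => ?_)
  rw [f.map_smul_univ, norm_smul, norm_prod]
  exact mul_le_of_le_one_left (norm_nonneg _)
    (Finset.prod_le_one (fun _ _ => norm_nonneg _) fun s _ => hP s _)

theorem symRep_scalar (σ : F →ₐ[ℚ_[p]] E) (n : ℕ) (z : Fˣ) (P : Sym E n) :
    symRep σ n (Matrix.GeneralLinearGroup.scalar (Fin 2) z) P = σ z ^ n • P := by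
  apply Subtype.ext
  change symAct σ _ P.1 = σ z ^ n • P.1
  have hX : (fun j => ∑ i, MvPolynomial.C (σ (Matrix.GeneralLinearGroup.scalar (Fin 2) z i j)) *
      MvPolynomial.X i) = fun j : Fin 2 => MvPolynomial.C (σ z) * MvPolynomial.X (R := E) j := by
    funext j
    fin_cases j <;> simp [Matrix.GeneralLinearGroup.scalar]
  rw [symAct, hX]
  conv_rhs => rw [← AlgHom.id_apply (R := E) P.1, ← MvPolynomial.aeval_X_left]
  rw [MvPolynomial.aeval_def, MvPolynomial.aeval_def, MvPolynomial.eval₂_eq',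
    MvPolynomial.eval₂_eq', Finset.smul_sum]
  refine Finset.sum_congr rfl fun m hm => ?_
  have hn := degree_eq_of_coeff_ne_zero P (MvPolynomial.mem_support_iff.1 hm)
  rw [Finsupp.degree_eq_sum] at hn
  rw [MvPolynomial.smul_eq_C_mul]
  simp only [mul_pow, Finset.prod_mul_distrib, Finset.prod_pow_eq_pow_sum, map_pow, hn]
  ring

theorem algRep_tprod {J : Finset (F →ₐ[ℚ_[p]] E)} (d : {σ // σ ∉ J} → ℕ) (g : GL (Fin 2) F)
    (P : ∀ σ, Sym E (d σ)) :
    algRep d g (PiTensorProduct.tprod E P) =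
      PiTensorProduct.tprod E fun σ => symRep σ.1 (d σ) g (P σ) :=
  PiTensorProduct.map_tprod _ _

variable (χ₁ χ₂ : F →*₀ E) {J : Finset (F →ₐ[ℚ_[p]] E)} (d : {σ // σ ∉ J} → ℕ)

/-- The pure tensors of `I(χ, J, d)`. -/
noncomputable def tmul : AlgSpace d →ₗ[E] ind χ₁ χ₂ J →ₗ[E] LocAnRep χ₁ χ₂ d :=
  TensorProduct.mk E (AlgSpace d) (ind χ₁ χ₂ J)

theorem locAnRep_tmul (g : GL (Fin 2) F) (w : AlgSpace d) (φ : ind χ₁ χ₂ J) :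
    locAnRep χ₁ χ₂ d g (tmul χ₁ χ₂ d w φ) =
      tmul χ₁ χ₂ d (algRep d g w) (indRep χ₁ χ₂ J g φ) :=
  rfl

theorem contract_tmul (l : Module.Dual E (AlgSpace d)) (w : AlgSpace d) (φ : ind χ₁ χ₂ J) :
    contract χ₁ χ₂ d l (tmul χ₁ χ₂ d w φ) = l w • φ :=
  rfl

/-- Two linear maps on `I(χ, J, d)` agree if they do on the pure tensors. -/
theorem locAnRep_linearMap_ext {M : Type*} [AddCommGroup M] [Module E M]
    {f g : LocAnRep χ₁ χ₂ d →ₗ[E] M}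
    (h : ∀ (P : ∀ σ, Sym E (d σ)) (φ : ind χ₁ χ₂ J),
      f (tmul χ₁ χ₂ d (PiTensorProduct.tprod E P) φ) =
        g (tmul χ₁ χ₂ d (PiTensorProduct.tprod E P) φ)) : f = g := by
  have h1 : (tmul χ₁ χ₂ d).compr₂ f = (tmul χ₁ χ₂ d).compr₂ g := by
    refine PiTensorProduct.ext (MultilinearMap.ext fun P => LinearMap.ext fun φ => h P φ)
  exact TensorProduct.ext (M := AlgSpace d) (N := ind χ₁ χ₂ J) h1

theorem indRep_scalar (z : Fˣ) (φ : ind χ₁ χ₂ J) :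
    indRep χ₁ χ₂ J (Matrix.GeneralLinearGroup.scalar (Fin 2) z) φ = (χ₁ z * χ₂ z) • φ := by
  apply Subtype.ext
  funext x
  change φ.1 (x * _) = χ₁ z * χ₂ z * φ.1 x
  have hc : x * Matrix.GeneralLinearGroup.scalar (Fin 2) z =
      Matrix.GeneralLinearGroup.scalar (Fin 2) z * x := by
    ext i j
    fin_cases i <;> fin_cases j <;>
      simp [Matrix.GeneralLinearGroup.scalar, Matrix.mul_apply, Fin.sum_univ_two, mul_comm]
  rw [hc, φ.2.1 _ _ (by simp [Matrix.GeneralLinearGroup.scalar])]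
  simp [Matrix.GeneralLinearGroup.scalar]

/-- The central character of `I(χ, J, d)`. -/
noncomputable def centralChar [Fintype {σ // σ ∉ J}] : Fˣ →* Eˣ :=
  (∏ σ : {σ // σ ∉ J}, (Units.map (σ.1 : F →* E)) ^ d σ) *
    (Units.map (χ₁ : F →* E) * Units.map (χ₂ : F →* E))

theorem centralChar_apply [Fintype {σ // σ ∉ J}] (z : Fˣ) :
    (centralChar χ₁ χ₂ d z : E) = (∏ σ, σ.1 (z : F) ^ d σ) * (χ₁ z * χ₂ z) := by
  simp [centralChar, Units.coe_prod, MonoidHom.finsetProd_apply]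

theorem locAnRep_scalar [Fintype {σ // σ ∉ J}] (z : Fˣ) (v : LocAnRep χ₁ χ₂ d) :
    locAnRep χ₁ χ₂ d (Matrix.GeneralLinearGroup.scalar (Fin 2) z) v =
      (centralChar χ₁ χ₂ d z : E) • v := by
  have : locAnRep χ₁ χ₂ d (Matrix.GeneralLinearGroup.scalar (Fin 2) z) =
      (centralChar χ₁ χ₂ d z : E) • LinearMap.id := by
    refine locAnRep_linearMap_ext χ₁ χ₂ d fun P φ => ?_
    rw [locAnRep_tmul, algRep_tprod, indRep_scalar, LinearMap.smul_apply, LinearMap.id_apply,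
      centralChar_apply]
    simp only [symRep_scalar]
    rw [MultilinearMap.map_smul_univ]
    simp only [map_smul, LinearMap.smul_apply, smul_smul]
    rw [mul_comm]
  rw [this]
  rfl

open Filter in
/-- Criterion for a sequence of pure tensors to tend to zero in `I(χ, J, d)`. -/
theorem tendsto_tmul_zero [IsUltrametricDist E] [Finite {σ // σ ∉ J}] {B : ℝ}
    (θ : ℕ → ind χ₁ χ₂ J) (h₁ : ∀ n, restr₁ χ₁ χ₂ J (θ n) = 0)
    (h₀ : ∀ n, NormLE J 1 (restr₀ χ₁ χ₂ J (θ n)).1 B) (P : ℕ → ∀ σ, Sym E (d σ))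
    (hP : ∀ n σ, (P n σ).1 ∈ integralPoly E) (t : ℕ → E) (ht : Tendsto t atTop (nhds 0)) :
    Tendsto (fun n => t n • tmul χ₁ χ₂ d (PiTensorProduct.tprod E (P n)) (θ n)) atTop
      (nhds (0 : LocAnRep χ₁ χ₂ d)) := by
  -- The topology is tested by contractions; each turns the sequence into `θ n` times a scalar
  -- tending to `0`, since `l` is bounded on integral tensors.
  rw [nhds_iInf, tendsto_iInf]
  intro l
  obtain ⟨D, hD⟩ := exists_bound_multilinear (l.compMultilinearMap (PiTensorProduct.tprod E))
  have hs : Tendsto (fun n => t n * l (PiTensorProduct.tprod E (P n))) atTop (nhds 0) := by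
    rw [tendsto_zero_iff_norm_tendsto_zero] at ht ⊢
    refine squeeze_zero (fun _ => norm_nonneg _) (fun n => ?_) (by simpa using ht.mul_const D)
    rw [norm_mul]
    exact mul_le_mul_of_nonneg_left (hD _ (hP n)) (norm_nonneg _)
  rw [@nhds_induced _ _ (indTopology χ₁ χ₂ J), tendsto_comap_iff, map_zero]
  have hc : (contract χ₁ χ₂ d l ∘ fun n =>
      t n • tmul χ₁ χ₂ d (PiTensorProduct.tprod E (P n)) (θ n)) =
      fun n => (t n * l (PiTensorProduct.tprod E (P n))) • θ n := by
    funext n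
    simp only [Function.comp_apply, map_smul, contract_tmul, smul_smul]
  have hn : @nhds _ (indTopology χ₁ χ₂ J) 0 =
      comap (restr₀ χ₁ χ₂ J) (@nhds _ (locAnTopology J) (restr₀ χ₁ χ₂ J 0)) ⊓
        comap (restr₁ χ₁ χ₂ J) (@nhds _ (locAnTopology J) (restr₁ χ₁ χ₂ J 0)) :=
    (@nhds_inf _ ((locAnTopology J).induced (restr₀ χ₁ χ₂ J))
      ((locAnTopology J).induced (restr₁ χ₁ χ₂ J)) 0).trans
      (congrArg₂ _ (@nhds_induced _ _ (locAnTopology J) (restr₀ χ₁ χ₂ J) 0)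
        (@nhds_induced _ _ (locAnTopology J) (restr₁ χ₁ χ₂ J) 0))
  rw [hc, hn, tendsto_inf, tendsto_comap_iff, tendsto_comap_iff]
  have e₁ : (restr₁ χ₁ χ₂ J ∘ fun n => (t n * l (PiTensorProduct.tprod E (P n))) • θ n) =
      fun _ => restr₁ χ₁ χ₂ J 0 := by
    funext n
    change (t n * l (PiTensorProduct.tprod E (P n))) • restr₁ χ₁ χ₂ J (θ n) = _
    rw [h₁, smul_zero]
    rfl
  refine ⟨?_, by rw [e₁]; exact @tendsto_const_nhds _ (locAnTopology J) _ _ _⟩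
  let : TopologicalSpace (locAn J) := locAnTopology J
  have hw : WithSeminorms
      (fun q : {q : Seminorm E (locAn J) // IsAdmissibleSeminorm J q} => q.1) := ⟨rfl⟩
  refine (hw.tendsto_nhds _ _).2 fun q ε hε => ?_
  -- Only the bound of `q` on `𝓕_1` matters, because all the `θ n` lie in one ball of that space.
  obtain ⟨C, hC⟩ := q.2.2 1
  have h0 : Tendsto (fun n => ‖t n * l (PiTensorProduct.tprod E (P n))‖ * (C * B)) atTop
      (nhds 0) := by
    rw [tendsto_zero_iff_norm_tendsto_zero] at hs
    simpa using hs.mul_const (C * B)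
  filter_upwards [h0.eventually (gt_mem_nhds hε)] with n hn
  refine lt_of_le_of_lt ?_ hn
  have e₀ : (restr₀ χ₁ χ₂ J ∘ fun n => (t n * l (PiTensorProduct.tprod E (P n))) • θ n) n -
      restr₀ χ₁ χ₂ J 0 = (t n * l (PiTensorProduct.tprod E (P n))) • restr₀ χ₁ χ₂ J (θ n) :=
    sub_zero (G := locAn J) _
  rw [e₀, map_smul_eq_mul]
  exact mul_le_mul_of_nonneg_left (hC _ _ (h₀ n)) (norm_nonneg _)

/-- A continuous linear map is bounded on a set of pure tensors whose functions are bounded in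
`𝓕_1` along the first chart and vanish along the second. -/
theorem exists_bound_tmul [IsUltrametricDist E] [Finite {σ // σ ∉ J}] {V : Type*}
    [NormedAddCommGroup V] [NormedSpace E V] (ι : LocAnRep χ₁ χ₂ d →L[E] V) (B : ℝ) :
    ∃ C : ℝ, ∀ θ : ind χ₁ χ₂ J, restr₁ χ₁ χ₂ J θ = 0 → NormLE J 1 (restr₀ χ₁ χ₂ J θ).1 B →
      ∀ P : ∀ σ, Sym E (d σ), (∀ σ, (P σ).1 ∈ integralPoly E) →
        ‖ι (tmul χ₁ χ₂ d (PiTensorProduct.tprod E P) θ)‖ ≤ C := by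
  by_contra! hno
  -- If no bound existed, tensors with images larger than `pⁿ` could be chosen; multiplied by `pⁿ`,
  -- of norm `p⁻ⁿ`, they tend to `0` while their images keep norm above `1`.
  choose θ h₁ h₀ P hP hlt using fun n : ℕ => hno ((p : ℝ) ^ n)
  have hp : (1 : ℝ) < p := by exact_mod_cast (Fact.out : p.Prime).one_lt
  have ht : Filter.Tendsto (fun n : ℕ => (p : E) ^ n) Filter.atTop (nhds 0) := by
    refine tendsto_pow_atTop_nhds_zero_of_norm_lt_one ?_
    rw [norm_natCast_prime p]
    exact inv_lt_one_of_one_lt₀ hp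
  have h := (ι.continuous.tendsto 0).comp (tendsto_tmul_zero χ₁ χ₂ d θ h₁ h₀ P hP _ ht)
  rw [map_zero, tendsto_zero_iff_norm_tendsto_zero] at h
  obtain ⟨n, hn⟩ := (h.eventually (gt_mem_nhds one_pos)).exists
  simp only [Function.comp_apply, map_smul, norm_smul, norm_pow, norm_natCast_prime p] at hn
  have := hlt n
  rw [inv_pow, inv_mul_lt_iff₀ (by positivity)] at hn
  linarith

end Algebraic

/-! ### The cell in `P \ G`, cutting off, and upper triangular matrices in the charts. -/

section Cells

variable {p : ℕ} [Fact p.Prime]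
variable {F : Type*} [NontriviallyNormedField F] [NormedAlgebra ℚ_[p] F]
variable {E : Type*} [NontriviallyNormedField E] [NormedAlgebra ℚ_[p] E]

/-- The union of the cosets `P * chart₀ z` with `z ∈ 𝒪_F`. -/
def InCell (g : GL (Fin 2) F) : Prop := ‖g 1 1‖ ≤ ‖g 1 0‖

theorem inCell_mul {b : GL (Fin 2) F} (hb : b 1 0 = 0) (g : GL (Fin 2) F) :
    InCell (b * g) ↔ InCell g := by
  have hdet : b 1 1 ≠ 0 := fun h => b.det_ne_zero (by
    change b.1.det = 0
    rw [Matrix.det_fin_two]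
    simp [hb, h])
  have : ∀ j, (b * g) 1 j = b 1 1 * g 1 j := fun j => by
    simp [Matrix.mul_apply, Fin.sum_univ_two, hb]
  rw [InCell, InCell, this, this, norm_mul, norm_mul,
    mul_le_mul_iff_of_pos_left (norm_pos_iff.2 hdet)]

theorem norm_le_norm_iff_of_close [IsUltrametricDist F] {x y : Fin 2 → F}
    (h : ∀ j, ‖y j - x j‖ < max ‖x 0‖ ‖x 1‖) : ‖x 1‖ ≤ ‖x 0‖ ↔ ‖y 1‖ ≤ ‖y 0‖ := by
  have hlt : ∀ {a b : F}, ‖b - a‖ < ‖a‖ → ‖b‖ = ‖a‖ := fun {a b} hab => by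
    have := IsUltrametricDist.norm_add_eq_max_of_norm_ne_norm hab.ne
    rwa [sub_add_cancel, max_eq_right hab.le] at this
  have hle : ∀ a b : F, ‖b‖ ≤ max ‖b - a‖ ‖a‖ := fun a b => by
    simpa using IsUltrametricDist.norm_add_le_max (b - a) a
  rcases le_or_gt ‖x 1‖ ‖x 0‖ with h' | h'
  · rw [max_eq_left h'] at h
    refine iff_of_true h' ?_
    rw [hlt (h 0)]
    exact (hle (x 1) (y 1)).trans (max_le (h 1).le h')
  · rw [max_eq_right h'.le] at h
    refine iff_of_false h'.not_ge (not_le.2 ?_)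
    rw [hlt (h 1)]
    exact (hle (x 0) (y 0)).trans_lt (max_lt (h 0) h')

theorem chart₀_mul_apply (z : F) (M : GL (Fin 2) F) (j : Fin 2) :
    (chart₀ z * M) 1 j = -M 0 j + z * M 1 j := by
  simp [chart₀, Matrix.GeneralLinearGroup.mkOfDetNeZero, Matrix.mul_apply, Fin.sum_univ_two]

/-- Along every chart, the cell is a union of discs of a fixed radius. -/
theorem exists_radius_inCell (p : ℕ) [Fact p.Prime] [IsUltrametricDist F] (M : GL (Fin 2) F) :
    ∃ k : ℕ, ∀ x y : intSet F, ‖(y : F) - x‖ ≤ radius p k →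
      (InCell (chart₀ (x : F) * M) ↔ InCell (chart₀ (y : F) * M)) := by
  have hdet : M 0 0 * M 1 1 - M 0 1 * M 1 0 ≠ 0 := by
    have := M.det_ne_zero
    rwa [Matrix.det_fin_two] at this
  set D := ‖M 1 0‖ + ‖M 1 1‖ with hD
  have hD0 : 0 < D := by
    by_contra! hle
    have h0 : M 1 0 = 0 := norm_le_zero_iff.1 (by linarith [norm_nonneg (M 1 1)])
    have h1 : M 1 1 = 0 := norm_le_zero_iff.1 (by linarith [norm_nonneg (M 1 0)])
    simp [h0, h1] at hdet
  have hδ : 0 < ‖M 0 0 * M 1 1 - M 0 1 * M 1 0‖ := norm_pos_iff.2 hdet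
  have hp : ((p : ℝ)⁻¹) < 1 := inv_lt_one_of_one_lt₀
    (by exact_mod_cast (Fact.out : p.Prime).one_lt)
  obtain ⟨k, hk⟩ := exists_pow_lt_of_lt_one
    (show 0 < ‖M 0 0 * M 1 1 - M 0 1 * M 1 0‖ / D / D by positivity) hp
  refine ⟨k, fun x y hxy => norm_le_norm_iff_of_close (x := (chart₀ (x : F) * M) 1)
    (y := (chart₀ (y : F) * M) 1) fun j => ?_⟩
  rw [chart₀_mul_apply, chart₀_mul_apply]
  have h1 : ‖M 0 0 * M 1 1 - M 0 1 * M 1 0‖ / D ≤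
      max ‖(chart₀ (x : F) * M) 1 0‖ ‖(chart₀ (x : F) * M) 1 1‖ := by
    rw [div_le_iff₀ hD0]
    -- The determinant is a combination of the bottom row of `chart₀ x * M`, so that row is bounded
    -- below uniformly in `x`.
    have : M 0 0 * M 1 1 - M 0 1 * M 1 0 =
        (chart₀ (x : F) * M) 1 1 * M 1 0 - (chart₀ (x : F) * M) 1 0 * M 1 1 := by
      rw [chart₀_mul_apply, chart₀_mul_apply]
      ring
    rw [this, hD, mul_add]
    refine (norm_sub_le _ _).trans (add_le_add ?_ ?_)
    · rw [norm_mul]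
      exact mul_le_mul_of_nonneg_right (le_max_right _ _) (norm_nonneg _)
    · rw [norm_mul]
      exact mul_le_mul_of_nonneg_right (le_max_left _ _) (norm_nonneg _)
  refine lt_of_lt_of_le ?_ h1
  have h2 : -M 0 j + (y : F) * M 1 j - (-M 0 j + x * M 1 j) = ((y : F) - x) * M 1 j := by ring
  rw [h2, norm_mul]
  have h3 : ‖M 1 j‖ ≤ D := by
    fin_cases j <;> simp [hD]
  calc _ ≤ radius p k * D := mul_le_mul hxy h3 (norm_nonneg _) (radius_nonneg _ _)
    _ < _ := (lt_div_iff₀ hD0).1 hk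

open Classical in
/-- The restriction of `φ` to the translate of the cell by `γ⁻¹`, extended by zero. -/
noncomputable def cut [IsUltrametricDist F] {χ₁ χ₂ : F →*₀ E} {J : Finset (F →ₐ[ℚ_[p]] E)}
    (γ : GL (Fin 2) F) (φ : ind χ₁ χ₂ J) : ind χ₁ χ₂ J :=
  ⟨fun x => if InCell (x * γ) then φ.1 x else 0, fun b g hb => by
    simp only [mul_assoc, inCell_mul hb, φ.2.1 b g hb, mul_ite, mul_zero], fun g => by
    obtain ⟨k, hk⟩ := exists_radius_inCell p (g * γ)
    simp only [mul_assoc]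
    exact ite_mem_locAn (φ.2.2 g) _ k hk⟩

open Classical in
theorem cut_apply [IsUltrametricDist F] {χ₁ χ₂ : F →*₀ E} {J : Finset (F →ₐ[ℚ_[p]] E)}
    (γ : GL (Fin 2) F) (φ : ind χ₁ χ₂ J) (x : GL (Fin 2) F) :
    (cut γ φ).1 x = if InCell (x * γ) then φ.1 x else 0 :=
  rfl

/-- The matrix `[a, b; 0, d]`. -/
def upper (a b d : F) (h : a * d ≠ 0) : GL (Fin 2) F :=
  Matrix.GeneralLinearGroup.mkOfDetNeZero !![a, b; 0, d] (by simpa [Matrix.det_fin_two] using h)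

theorem mul_upper_apply_zero (x : GL (Fin 2) F) (a b d : F) (h : a * d ≠ 0) (i : Fin 2) :
    (x * upper a b d h) i 0 = x i 0 * a := by
  simp [upper, Matrix.GeneralLinearGroup.mkOfDetNeZero, Matrix.mul_apply, Fin.sum_univ_two]

theorem mul_upper_apply_one (x : GL (Fin 2) F) (a b d : F) (h : a * d ≠ 0) (i : Fin 2) :
    (x * upper a b d h) i 1 = x i 0 * b + x i 1 * d := by
  simp [upper, Matrix.GeneralLinearGroup.mkOfDetNeZero, Matrix.mul_apply, Fin.sum_univ_two]

/-- The source of the factor `χ₁(p)ᴺ`: `d` lands in the upper left entry of the triangular factor,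
where only `χ₁` sees it. -/
theorem chart₀_mul_upper (z a d : F) (hd : d ≠ 0) :
    chart₀ z * upper 1 (-a) d (by simpa using hd) =
      upper d 0 1 (by simpa using hd) * chart₀ (a + d * z) := by
  ext i j
  fin_cases i <;> fin_cases j <;>
    simp [chart₀, upper, Matrix.GeneralLinearGroup.mkOfDetNeZero]
  ring

theorem inCell_chart₀_mul_upper (z d : F) (hd : d ≠ 0) :
    InCell (chart₀ z * upper d 0 1 (by simpa using hd)) ↔ ‖z‖ ≤ ‖d‖ := by
  rw [InCell, mul_upper_apply_zero, mul_upper_apply_one]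
  simp [chart₀, Matrix.GeneralLinearGroup.mkOfDetNeZero]

/-- For `z ≠ 0`, `chart₁ z` lies over the point `z⁻¹` of the first chart, of norm at least `1 >
‖d‖`; for `z = 0` it lies over infinity. -/
theorem not_inCell_chart₁_mul_upper {z d : F} (hz : ‖z‖ ≤ 1) (hd : d ≠ 0) (hd' : ‖d‖ < 1) :
    ¬ InCell (chart₁ z * upper d 0 1 (by simpa using hd)) := by
  rw [InCell, mul_upper_apply_zero, mul_upper_apply_one]
  simp only [chart₁, Matrix.GeneralLinearGroup.mkOfDetNeZero]
  simp
  nlinarith [norm_nonneg z, norm_nonneg d]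

end Cells

/-! ### Vanishing of `ι` when `‖χ₁(p)‖ < 1`. -/

section Vanishing

variable {p : ℕ} [Fact p.Prime]
variable {F : Type*} [NontriviallyNormedField F] [NormedAlgebra ℚ_[p] F]
variable {E : Type*} [NontriviallyNormedField E] [NormedAlgebra ℚ_[p] E]
variable {χ₁ χ₂ : F →*₀ E} {J : Finset (F →ₐ[ℚ_[p]] E)}

/-- The contracting matrix `[1, -a; 0, pᴺ]`, which maps the disc `a + pᴺ 𝒪_F` onto `𝒪_F`. -/
def zoom (p : ℕ) [Fact p.Prime] [NormedAlgebra ℚ_[p] F] (N : ℕ) (a : F) : GL (Fin 2) F :=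
  upper 1 (-a) ((p : F) ^ N) (by simpa using fun h => absurd h (natCast_prime_ne_zero p F))

/-- The matrix `[p, 0; 0, 1]`. -/
def diagP (p : ℕ) [Fact p.Prime] (F : Type*) [NontriviallyNormedField F] [NormedAlgebra ℚ_[p] F] :
    GL (Fin 2) F :=
  upper (p : F) 0 1 (by simpa using natCast_prime_ne_zero p F)

theorem norm_zoom_apply_le (N : ℕ) {a : F} (ha : ‖a‖ ≤ 1) (i j : Fin 2) :
    ‖zoom p N a i j‖ ≤ 1 := by
  have : ‖(p : F)‖ ^ N ≤ 1 := by
    rw [← norm_pow, norm_natCast_prime_pow]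
    simpa [radius] using radius_anti (p := p) (Nat.zero_le N)
  fin_cases i <;> fin_cases j <;>
    simp [zoom, upper, Matrix.GeneralLinearGroup.mkOfDetNeZero, ha, this]

variable [IsUltrametricDist F]

/-- The part of `φ` on the disc `a + pᴺ⁺¹ 𝒪_F`, rescaled to the disc `p 𝒪_F`. -/
noncomputable def rescaledPiece (φ : ind χ₁ χ₂ J) (N : ℕ) (a : F) : ind χ₁ χ₂ J :=
  (χ₁ (p : F) ^ N)⁻¹ • cut (diagP p F) (indRep χ₁ χ₂ J (zoom p N a) φ)

open Classical in
theorem rescaledPiece_apply (φ : ind χ₁ χ₂ J) (N : ℕ) (a : F) (x : GL (Fin 2) F) :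
    (rescaledPiece φ N a).1 x =
      (χ₁ (p : F) ^ N)⁻¹ * if InCell (x * diagP p F) then φ.1 (x * zoom p N a) else 0 :=
  rfl

/-- This is why pieces are rescaled to `p 𝒪_F` and not `𝒪_F`: the two charts overlap where `‖z‖ =
1`, and the smaller disc avoids the second chart. -/
theorem restr₁_rescaledPiece (φ : ind χ₁ χ₂ J) (N : ℕ) (a : F) :
    restr₁ χ₁ χ₂ J (rescaledPiece φ N a) = 0 := by
  apply Subtype.ext
  funext z
  change (rescaledPiece φ N a).1 (chart₁ z) = 0
  have hp : ‖(p : F)‖ < 1 := by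
    rw [norm_natCast_prime p]
    exact inv_lt_one_of_one_lt₀ (by exact_mod_cast (Fact.out : p.Prime).one_lt)
  rw [rescaledPiece_apply, if_neg, mul_zero]
  exact not_inCell_chart₁_mul_upper z.2 (natCast_prime_ne_zero p F) hp

/-- The point is that `B` depends neither on `N` nor on `a`. -/
theorem normLE_restr₀_rescaledPiece {φ : ind χ₁ χ₂ J} {h N : ℕ} {B : ℝ}
    (H : NormLE J h (restr₀ χ₁ χ₂ J φ).1 B) (hN : h ≤ N + 1) {a : F} (ha : ‖a‖ ≤ 1) :
    NormLE J 1 (restr₀ χ₁ χ₂ J (rescaledPiece φ N a)).1 B := by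
  have hp0 := natCast_prime_ne_zero p F
  have hr : radius p 1 = ‖(p : F)‖ := by rw [norm_natCast_prime p, radius, pow_one]
  refine H.rescale hN _ a ha (fun z hz => ?_) fun z w hz hw => ?_
  · change (rescaledPiece φ N a).1 (chart₀ z) = 0
    rw [rescaledPiece_apply, if_neg, mul_zero]
    rwa [diagP, inCell_chart₀_mul_upper _ _ hp0, ← hr]
  · change (rescaledPiece φ N a).1 (chart₀ z) = φ.1 (chart₀ w)
    have hχ : χ₁ (p : F) ^ N ≠ 0 := pow_ne_zero _ ((map_ne_zero χ₁).2 hp0)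
    rw [rescaledPiece_apply, if_pos (by rwa [diagP, inCell_chart₀_mul_upper _ _ hp0, ← hr]), zoom,
      chart₀_mul_upper _ _ _ (pow_ne_zero N hp0), φ.2.1 _ _ (by
        simp [upper, Matrix.GeneralLinearGroup.mkOfDetNeZero]), ← hw]
    simp [upper, Matrix.GeneralLinearGroup.mkOfDetNeZero, hχ]

/-- The translates of the rescaled pieces add up to `φ`. -/
theorem eq_sum_rescaledPiece {φ : ind χ₁ χ₂ J} (hφ : ∀ x, ¬ InCell x → φ.1 x = 0) (N : ℕ)
    {T : Finset F} (hT : ∀ z : F, ‖z‖ ≤ 1 → ∃! t, t ∈ T ∧ ‖z - t‖ ≤ radius p (N + 1)) :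
    φ = ∑ a ∈ T, χ₁ (p : F) ^ N • indRep χ₁ χ₂ J (zoom p N a)⁻¹ (rescaledPiece φ N a) := by
  classical
  have hp0 := natCast_prime_ne_zero p F
  have hχ : χ₁ (p : F) ^ N ≠ 0 := pow_ne_zero _ ((map_ne_zero χ₁).2 hp0)
  apply Subtype.ext
  funext x
  have hterm : ∀ a : F,
      (χ₁ (p : F) ^ N • indRep χ₁ χ₂ J (zoom p N a)⁻¹ (rescaledPiece φ N a)).1 x =
        if ‖x 1 1 + x 1 0 * a‖ ≤ radius p (N + 1) * ‖x 1 0‖ then φ.1 x else 0 := by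
    intro a
    change χ₁ (p : F) ^ N * (rescaledPiece φ N a).1 (x * (zoom p N a)⁻¹) = _
    rw [rescaledPiece_apply, mul_inv_cancel_left₀ hχ, inv_mul_cancel_right]
    obtain ⟨y, rfl⟩ : ∃ y, x = y * zoom p N a := ⟨x * (zoom p N a)⁻¹, by simp⟩
    rw [mul_inv_cancel_right]
    refine if_congr ?_ rfl rfl
    rw [InCell, diagP, mul_upper_apply_zero, mul_upper_apply_one, zoom, mul_upper_apply_zero,
      mul_upper_apply_one]
    have h1 : y 1 0 * -a + y 1 1 * (p : F) ^ N + y 1 0 * 1 * a = (p : F) ^ N * y 1 1 := by ring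
    rw [h1, ← norm_natCast_prime_pow p F (N + 1), ← norm_mul]
    have h2 : (p : F) ^ (N + 1) * (y 1 0 * 1) = (p : F) ^ N * (y 1 0 * p) := by ring
    rw [h2, norm_mul _ (y 1 1), norm_mul _ (y 1 0 * p),
      mul_le_mul_iff_of_pos_left (norm_pos_iff.2 (pow_ne_zero N hp0))]
    simp
  rw [Submodule.coe_sum, Finset.sum_apply]
  by_cases hx : InCell x
  · have hx0 : x 1 0 ≠ 0 := fun h0 => x.det_ne_zero (by
      have h1 : x 1 1 = 0 := by simpa [InCell, h0] using hx
      rw [Matrix.det_fin_two]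
      simp [h0, h1])
    have hiff : ∀ a : F, ‖x 1 1 + x 1 0 * a‖ ≤ radius p (N + 1) * ‖x 1 0‖ ↔
        ‖-(x 1 1 / x 1 0) - a‖ ≤ radius p (N + 1) := fun a => by
      have : x 1 1 + x 1 0 * a = -((-(x 1 1 / x 1 0) - a) * x 1 0) := by
        field_simp
        ring
      rw [this, norm_neg, norm_mul, mul_le_mul_iff_of_pos_right (norm_pos_iff.2 hx0)]
    obtain ⟨t, ⟨ht, hzt⟩, huniq⟩ := hT (-(x 1 1 / x 1 0)) (by
      rw [norm_neg, norm_div]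
      exact div_le_one_of_le₀ hx (norm_nonneg _))
    rw [Finset.sum_eq_single_of_mem t ht fun b hb hbt => ?_]
    · exact ((hterm t).trans (if_pos ((hiff t).2 hzt))).symm
    · exact (hterm b).trans (if_neg fun h => hbt (huniq b ⟨hb, (hiff b).1 h⟩))
  · rw [hφ x hx]
    refine (Finset.sum_eq_zero fun a _ => (hterm a).trans ?_).symm
    rw [hφ x hx, ite_self]

variable [FiniteDimensional ℚ_[p] F] [IsUltrametricDist E] [CompleteSpace E] {d : {σ // σ ∉ J} → ℕ} [Finite {σ // σ ∉ J}]
variable {B : Type*} [NormedAddCommGroup B] [NormedSpace E B] [IsUltrametricDist B]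
  {ρB : Representation E (GL (Fin 2) F) B} {ι : LocAnRep χ₁ χ₂ d →L[E] B}

theorem map_integral_tmul_eq_zero (hρ : ∀ g v, ‖ρB g v‖ = ‖v‖)
    (hι : ∀ g v, ι (locAnRep χ₁ χ₂ d g v) = ρB g (ι v)) (hχ : ‖χ₁ (p : F)‖ < 1)
    {φ : ind χ₁ χ₂ J} (hφ : ∀ x, ¬ InCell x → φ.1 x = 0) {P : ∀ σ, Sym E (d σ)}
    (hP : ∀ σ, (P σ).1 ∈ integralPoly E) :
    ι (tmul χ₁ χ₂ d (PiTensorProduct.tprod E P) φ) = 0 := by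
  obtain ⟨h, C, hC⟩ := exists_normLE (restr₀ χ₁ χ₂ J φ).2
  obtain ⟨D, hD⟩ := exists_bound_tmul χ₁ χ₂ d ι C
  have hnorm : ∀ g v, ‖ι (locAnRep χ₁ χ₂ d g v)‖ = ‖ι v‖ := fun g v => by rw [hι, hρ]
  have hle : ∀ N, h ≤ N → ‖ι (tmul χ₁ χ₂ d (PiTensorProduct.tprod E P) φ)‖ ≤
      ‖χ₁ (p : F)‖ ^ N * |D| := by
    intro N hN
    obtain ⟨T, hT, hT'⟩ := exists_finset_representatives p F (N + 1)
    rw [eq_sum_rescaledPiece hφ N hT', map_sum, map_sum]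
    refine IsUltrametricDist.norm_sum_le_of_forall_le_of_nonneg (by positivity) fun a ha => ?_
    rw [map_smul, map_smul, norm_smul, norm_pow]
    refine mul_le_mul_of_nonneg_left (le_trans ?_ (le_abs_self D)) (by positivity)
    -- Isometry allows a translation by `zoom`, which undoes its inverse on the function and leaves
    -- an integral matrix acting on `P`.
    rw [← hnorm (zoom p N a), locAnRep_tmul, algRep_tprod, Representation.self_inv_apply]
    exact hD _ (restr₁_rescaledPiece φ N a)
      (normLE_restr₀_rescaledPiece hC (hN.trans N.le_succ) (hT a ha)) _
      fun σ => symAct_mem_integralPoly σ.1 (norm_zoom_apply_le N (hT a ha)) (hP σ)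
  have hlim : Filter.Tendsto (fun N : ℕ => ‖χ₁ (p : F)‖ ^ N * |D|) Filter.atTop (nhds 0) := by
    simpa using (tendsto_pow_atTop_nhds_zero_of_lt_one (norm_nonneg _) hχ).mul_const |D|
  refine norm_le_zero_iff.1 (ge_of_tendsto hlim ?_)
  filter_upwards [Filter.eventually_ge_atTop h] with N hN using hle N hN

theorem map_tmul_eq_zero_of_inCell (hρ : ∀ g v, ‖ρB g v‖ = ‖v‖)
    (hι : ∀ g v, ι (locAnRep χ₁ χ₂ d g v) = ρB g (ι v)) (hχ : ‖χ₁ (p : F)‖ < 1)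
    {φ : ind χ₁ χ₂ J} (hφ : ∀ x, ¬ InCell x → φ.1 x = 0) (P : ∀ σ, Sym E (d σ)) :
    ι (tmul χ₁ χ₂ d (PiTensorProduct.tprod E P) φ) = 0 := by
  have := Fintype.ofFinite {σ // σ ∉ J}
  choose t ht htP using fun σ => exists_smul_mem_integralPoly p (P σ).1
  have h0 := map_integral_tmul_eq_zero hρ hι hχ hφ (P := fun σ => t σ • P σ) htP
  rw [MultilinearMap.map_smul_univ, map_smul, LinearMap.smul_apply, map_smul] at h0
  exact (smul_eq_zero.1 h0).resolve_left (Finset.prod_ne_zero_iff.2 fun σ _ => ht σ)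

/-- The matrix `[0, 1; 1, 0]`. -/
def swap (F : Type*) [NontriviallyNormedField F] : GL (Fin 2) F :=
  Matrix.GeneralLinearGroup.mkOfDetNeZero !![0, 1; 1, 0] (by simp [Matrix.det_fin_two])

/-- If `‖χ₁ p‖ < 1`, every equivariant continuous map to a unitary representation vanishes. -/
theorem map_eq_zero_of_norm_lt_one (hρ : ∀ g v, ‖ρB g v‖ = ‖v‖)
    (hι : ∀ g v, ι (locAnRep χ₁ χ₂ d g v) = ρB g (ι v)) (hχ : ‖χ₁ (p : F)‖ < 1)
    (v : LocAnRep χ₁ χ₂ d) : ι v = 0 := by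
  have hnorm : ∀ g v, ‖ι (locAnRep χ₁ χ₂ d g v)‖ = ‖ι v‖ := fun g v => by rw [hι, hρ]
  have : (ι : LocAnRep χ₁ χ₂ d →ₗ[E] B) = 0 := by
    refine locAnRep_linearMap_ext χ₁ χ₂ d fun P φ => ?_
    change ι (tmul χ₁ χ₂ d (PiTensorProduct.tprod E P) φ) = 0
    have h₁ : ι (tmul χ₁ χ₂ d (PiTensorProduct.tprod E P) (cut 1 φ)) = 0 := by
      refine map_tmul_eq_zero_of_inCell hρ hι hχ (fun x hx => ?_) P
      rw [cut_apply, mul_one, if_neg hx]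
    -- The remainder lives off the cell, where `‖x 1 0‖ < ‖x 1 1‖`; exchanging the columns moves its
    -- support into the cell.
    have h₂ : ι (tmul χ₁ χ₂ d (PiTensorProduct.tprod E P) (φ - cut 1 φ)) = 0 := by
      rw [← norm_eq_zero, ← hnorm (swap F), locAnRep_tmul, algRep_tprod, norm_eq_zero]
      refine map_tmul_eq_zero_of_inCell hρ hι hχ (fun x hx => ?_) _
      change φ.1 (x * swap F) - (cut 1 φ).1 (x * swap F) = 0
      rw [cut_apply, if_pos, sub_self]
      have e0 : (x * swap F) 1 0 = x 1 1 := by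
        simp [swap, Matrix.GeneralLinearGroup.mkOfDetNeZero, Matrix.mul_apply, Fin.sum_univ_two]
      have e1 : (x * swap F) 1 1 = x 1 0 := by
        simp [swap, Matrix.GeneralLinearGroup.mkOfDetNeZero, Matrix.mul_apply, Fin.sum_univ_two]
      rw [mul_one, InCell, e0, e1]
      exact (not_le.1 hx).le
    rw [map_sub, map_sub, h₁, sub_zero] at h₂
    exact h₂
  exact LinearMap.congr_fun this v

end Vanishing

end PadicGL2

theorem proposition1p1 {p : ℕ} [Fact p.Prime]
    {F : Type*} [NontriviallyNormedField F] [NormedAlgebra ℚ_[p] F] [FiniteDimensional ℚ_[p] F]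
    {E : Type*} [NontriviallyNormedField E] [NormedAlgebra ℚ_[p] E] [FiniteDimensional ℚ_[p] E]
    (hFE : Nat.card (F →ₐ[ℚ_[p]] E) = Module.finrank ℚ_[p] F)
    (J : Finset (F →ₐ[ℚ_[p]] E)) (d : {σ // σ ∉ J} → ℕ)
    (χ₁ χ₂ : F →*₀ E) (hχ₁ : PadicGL2.IsLocallyAnalyticChar J χ₁)
    (hχ₂ : PadicGL2.IsLocallyAnalyticChar J χ₂)
    {B : Type*} [NormedAddCommGroup B] [NormedSpace E B] [CompleteSpace B] [IsUltrametricDist B]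
    (ρB : Representation E (GL (Fin 2) F) B) (ι : PadicGL2.LocAnRep χ₁ χ₂ d →L[E] B)
    (hB : PadicGL2.IsUniversalUnitaryCompletion (PadicGL2.locAnRep χ₁ χ₂ d) ρB ι)
    (hne : Nontrivial B) :
    (∃ ω : Fˣ →* Eˣ,
      (∀ (z : Fˣ) (v : PadicGL2.LocAnRep χ₁ χ₂ d),
        PadicGL2.locAnRep χ₁ χ₂ d (Matrix.GeneralLinearGroup.scalar (Fin 2) z) v =
          (ω z : E) • v) ∧
      ∀ z : Fˣ, ‖(ω z : E)‖ = 1) ∧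
    PadicGL2.val p (χ₁ (p : F)) + PadicGL2.val p (χ₂ (p : F)) + PadicGL2.totalWeight d = 0 ∧
    0 ≤ PadicGL2.val p (χ₂ (p : F)) + PadicGL2.totalWeight d := by
  open PadicGL2 in
  have : IsUltrametricDist F := IsUltrametricDist.of_normedAlgebra ℚ_[p]
  have : IsUltrametricDist E := IsUltrametricDist.of_normedAlgebra ℚ_[p]
  have : CompleteSpace E := FiniteDimensional.complete ℚ_[p] E
  have := Fintype.ofFinite {σ // σ ∉ J}
  obtain ⟨v, hv⟩ : ∃ v, ι v ≠ 0 := by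
    by_contra! h0
    obtain ⟨b, hb⟩ := exists_ne (0 : B)
    -- Uniqueness for `ι` itself: if `ι = 0`, the identity and `0` both factor it.
    have huniq := (hB.universal B ρB hB.unitary ι hB.equivariant).unique
      (y₁ := ContinuousLinearMap.id E B) (y₂ := 0) (by simp) (by simp [h0])
    exact hb (by simpa using congrArg (fun ψ : B →L[E] B => ψ b) huniq)
  have hω : ∀ z : Fˣ, ‖(centralChar χ₁ χ₂ d z : E)‖ = 1 := fun z => by
    have h1 := hB.equivariant (Matrix.GeneralLinearGroup.scalar (Fin 2) z) v
    have h2 := congrArg norm h1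
    rw [hB.unitary.norm_map, locAnRep_scalar, map_smul, norm_smul] at h2
    exact mul_right_cancel₀ (norm_ne_zero_iff.2 hv) (h2.trans (one_mul _).symm)
  have hp0 := natCast_prime_ne_zero p F
  have hp1 : (1 : ℝ) < p := by exact_mod_cast (Fact.out : p.Prime).one_lt
  have hc₁ : χ₁ (p : F) ≠ 0 := (map_ne_zero χ₁).2 hp0
  have hc₂ : χ₂ (p : F) ≠ 0 := (map_ne_zero χ₂).2 hp0
  have hsum : val p (χ₁ (p : F)) + val p (χ₂ (p : F)) + totalWeight d = 0 := by
    have h1 := hω (Units.mk0 (p : F) hp0)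
    rw [centralChar_apply] at h1
    simp only [Units.val_mk0, map_natCast, Finset.prod_pow_eq_pow_sum, norm_mul, norm_pow,
      norm_natCast_prime p E] at h1
    have h2 := congrArg (Real.logb p) h1
    have hpos : (0 : ℝ) < p := by linarith
    rw [Real.logb_mul (by positivity) (mul_ne_zero (norm_ne_zero_iff.2 hc₁)
      (norm_ne_zero_iff.2 hc₂)), Real.logb_mul (norm_ne_zero_iff.2 hc₁) (norm_ne_zero_iff.2 hc₂),
      Real.logb_pow, Real.logb_inv, Real.logb_self_eq_one hp1, Real.logb_one] at h2
    rw [val, val, totalWeight, finsum_eq_sum_of_fintype]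
    linarith
  refine ⟨⟨centralChar χ₁ χ₂ d, locAnRep_scalar χ₁ χ₂ d, hω⟩, hsum, ?_⟩
  -- By `hsum`, the quantity in (ii) is `-val p (χ₁ p)`, the logarithm of this norm.
  have hle : 1 ≤ ‖χ₁ (p : F)‖ := by
    by_contra! hlt
    exact hv (map_eq_zero_of_norm_lt_one hB.unitary.norm_map hB.equivariant hlt v)
  have := Real.logb_nonneg hp1 hle
  rw [val] at hsum ⊢
  rw [val] at hsum
  linarith
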